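/- **Setting.** Let $\mathcal X$ be a finite set with $|\mathcal X|\ge 3$, let $\mathcal Y,\mathcal U,\mathcal Z$ be standard Borel spaces (e.g. countable sets), $\mathcal Y\neq\emptyset$, and fix a horizon $T$. A *loop* $S$ is a cloud-control system with an output privacy filter: for $t=1,\dots,T$ the private state $X_t\in\mathcal X$ is generated by a plant kernel $P(x_t\mid x^{t-1},u^{t-1})$, the raw measurement $Z_t\in\mathcal Z$ by a sensor kernel $P(z_t\mid x^t,u^{t-1})$, the published output $Y_t\in\mathcal Y$ by the filter $P(y_t\mid y^{t-1},u^{t-1},z^t)$, and the input $U_t\in\mathcal U$, applied directly to the plant, by the cloud's controller $P(u_t\mid y^t,u^{t-1})$. Write $x^t=(x_1,\dots,x_t)$, and $$I(X^T\to Y^T\,\|\,U^{T-1})=\sum_{t=1}^T I(X^t;Y_t\mid Y^{t-1},U^{t-1}),$$ where $I(X;Y\mid Z)=\mathbb E_{P_Z}I(X;Y\mid z)$. A *loss function* on a finite alphabet $\mathcal A$ is a map $\ell:\mathcal A\times\mathcal P(\mathcal A)\to(-\infty,+\infty]$ (with $\mathcal P(\mathcal A)$ the probability distributions on $\mathcal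 A$) whose Bayes envelope $\inf_{Q}\mathbb E_{P}\,\ell(X,Q)$ is finite for every $P\in\mathcal P(\mathcal A)$. **Postulates.** A real-valued function $J$ of loops satisfies the postulates if there is one loss function $\ell$ on the alphabet $\mathcal H=\bigsqcup_{t=1}^T\mathcal X^t$ of state histories (so that every $X^t$ is an $\mathcal H$-valued variable) such that: 1. (Bayes-envelope leakage) for every law $P_{X,Y}$ on $\mathcal H\times\mathcal Y$ the leakage is $$L(\ell,P_{X,Y})=\inf_{Q}\mathbb E_{P_X}[\ell(X,Q)]-\mathbb E_{P_Y}\inf_{Q}\mathbb E_{P_{X|Y}}[\ell(X,Q)];$$ 2. (data-processing axiom) $L(\ell,P_{\tau(X),Y})=L(\ell,P_{X,Y})$ for every law $P_{X,Y}$ on $\mathcal H\times\mathcal Y$ and every $\tau:\mathcal H\to\mathcal H$ such that $\tau(X)$ is a sufficient statistic of $X$ for $Y$, i.e. the Markov chains $\tau(X)-X-Y$ and $X-\tau(X)-Y$ hold; 3. (private and public variables) at time $t$, $X^t$ is private and $Y^{t-1},U^{t-1}$ are public, so the expected instantaneous loss at time $t$ is $\mathbb E_{P_{Y^{t-1},U^{t-1}}}L(\ell,P_{X^t,Y_t\mid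 y^{t-1},u^{t-1}})$; 4. (stage additivity) $J(S)$ is the sum over $t=1,\dots,T$ of the expected instantaneous losses. **Proposition.** $I(X^T\to Y^T\|U^{T-1})$ is finite for every loop, and up to positive multiplicative factors it is the only privacy measure, other than the identically zero one, that satisfies the postulates: (a) if $J$ satisfies the postulates and is not identically zero, there is a constant $c>0$ with $J=c\,I(X^T\to Y^T\|U^{T-1})$ for all loops; (b) for every $c>0$, $c\,I(X^T\to Y^T\|U^{T-1})$ satisfies the postulates; (c) if instead of one $\ell$ a separate loss function $\ell_t$ on $\mathcal X^t$ is allowed for each $t$, with 1 and 2 required only for each $\ell_t$ on $\mathcal X^t\times\mathcal Y$ and maps $\tau:\mathcal X^t\to\mathcal X^t$, and $J$ is the sum of the resulting expected instantaneous losses, then there are constants $c_1,\dots,c_T\ge 0$ with $J=\sum_{t=1}^T c_t\,I(X^t;Y_t\mid Y^{t-1},U^{t-1})$ for all loops. -/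

import Mathlib

open MeasureTheory ProbabilityTheory
open scoped ENNReal

noncomputable section

namespace CloudPrivacy

/-! ### Single-stage disclosure: loss functions, Bayes envelope, leakage -/

section SingleStage

variable {𝒜 𝒴 : Type*} [Fintype 𝒜] [MeasurableSpace 𝒜] [DiscreteMeasurableSpace 𝒜]
  [MeasurableSpace 𝒴] [StandardBorelSpace 𝒴]

/-- `S(P, Q) = E_P ℓ(X, Q)`, the expected loss under the true law `P` when `Q` is assumed.
Loss values may be `+∞` (as for the logarithmic loss); `0 * ∞ = 0`. -/
def expectedLoss (ℓ : 𝒜 → ProbabilityMeasure 𝒜 → EReal) (P Q : ProbabilityMeasure 𝒜) : EReal :=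
  ∑ x, (((P : Measure 𝒜).real {x} : ℝ) : EReal) * ℓ x Q

/-- The Bayes envelope `inf_Q E_P ℓ(X, Q)`. -/
def bayesEnvelope (ℓ : 𝒜 → ProbabilityMeasure 𝒜 → EReal) (P : ProbabilityMeasure 𝒜) : EReal :=
  ⨅ Q : ProbabilityMeasure 𝒜, expectedLoss ℓ P Q

/-- A loss function: values in `(-∞, +∞]`, and a finite Bayes envelope at every law, so that
differences of Bayes envelopes are defined. -/
def IsLossFunction (ℓ : 𝒜 → ProbabilityMeasure 𝒜 → EReal) : Prop :=
  (∀ x Q, ℓ x Q ≠ ⊥) ∧ ∀ P, bayesEnvelope ℓ P ≠ ⊥ ∧ bayesEnvelope ℓ P ≠ ⊤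

/-- The conditional law `P_{X|Y=y}` of the first coordinate under `P = P_{X,Y}`. -/
def posterior (P : ProbabilityMeasure (𝒜 × 𝒴)) (y : 𝒴) : ProbabilityMeasure 𝒜 :=
  haveI : Nonempty 𝒜 := P.nonempty.map Prod.fst
  ⟨condDistrib Prod.fst Prod.snd (P : Measure (𝒜 × 𝒴)) y, inferInstance⟩

/-- Expected decrease of the Bayes envelope caused by the disclosure of `Y`:
`inf_Q E_{P_X} ℓ(X, Q) - E_{P_Y} inf_Q E_{P_{X|Y}} ℓ(X, Q)`. -/
def envelopeDrop (ℓ : 𝒜 → ProbabilityMeasure 𝒜 → EReal)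
    (P : ProbabilityMeasure (𝒜 × 𝒴)) : ℝ :=
  (bayesEnvelope ℓ (P.map measurable_fst.aemeasurable)).toReal
    - ∫ y, (bayesEnvelope ℓ (posterior P y)).toReal ∂(P : Measure (𝒜 × 𝒴)).snd

/-- `T(X)` is a sufficient statistic of `X` for `Y` under `P = P_{X,Y}`: the Markov chains
`T(X) - X - Y` and `X - T(X) - Y` hold. -/
def IsSufficient (P : ProbabilityMeasure (𝒜 × 𝒴)) (T : 𝒜 → 𝒜) : Prop :=
  CondIndepFun (MeasurableSpace.comap (Prod.fst : 𝒜 × 𝒴 → 𝒜) inferInstance)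
      measurable_fst.comap_le
      (fun p : 𝒜 × 𝒴 => T p.1) (fun p : 𝒜 × 𝒴 => p.2) (P : Measure (𝒜 × 𝒴)) ∧
  CondIndepFun (MeasurableSpace.comap (fun p : 𝒜 × 𝒴 => T p.1) inferInstance)
      ((Measurable.of_discrete (f := T)).comp measurable_fst).comap_le
      (fun p : 𝒜 × 𝒴 => p.1) (fun p : 𝒜 × 𝒴 => p.2) (P : Measure (𝒜 × 𝒴))

/-- The law `P_{f(X),Y}` of `(f(X), Y)` when `(X, Y)` has law `P`. -/
def mapPrivate {ℬ : Type*} [MeasurableSpace ℬ] (f : 𝒜 → ℬ)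
    (P : ProbabilityMeasure (𝒜 × 𝒴)) : ProbabilityMeasure (ℬ × 𝒴) :=
  P.map (((Measurable.of_discrete (f := f)).prodMap measurable_id).aemeasurable
    (f := Prod.map f id))

/-- The data-processing axiom: replacing the private variable by a sufficient statistic of it
does not change the leakage. -/
def DataProcessingAxiom (L : ProbabilityMeasure (𝒜 × 𝒴) → ℝ) : Prop :=
  ∀ (P : ProbabilityMeasure (𝒜 × 𝒴)) (T : 𝒜 → 𝒜), IsSufficient P T →
    L (mapPrivate T P) = L P

/-- `L` is the privacy leakage function `L(ℓ, ·)` of the loss function `ℓ` (expected decrease of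
the Bayes envelope), and it satisfies the data-processing axiom. -/
structure IsPrivacyLeakage (ℓ : 𝒜 → ProbabilityMeasure 𝒜 → EReal)
    (L : ProbabilityMeasure (𝒜 × 𝒴) → ℝ) : Prop where
  isLossFunction : IsLossFunction ℓ
  eq_envelopeDrop : ∀ P, L P = envelopeDrop ℓ P
  dataProcessing : DataProcessingAxiom L

/-- Shannon's mutual information `I(X;Y)` under the joint law `P`. -/
def mutualInfo (P : ProbabilityMeasure (𝒜 × 𝒴)) : ℝ≥0∞ :=
  InformationTheory.klDiv (P : Measure (𝒜 × 𝒴))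
    ((P : Measure (𝒜 × 𝒴)).fst.prod (P : Measure (𝒜 × 𝒴)).snd)

end SingleStage

/-! ### The output-filter architecture -/

/-- One time step `(((X_t, Z_t), Y_t), U_t)`: state, raw measurement, published (filtered)
output, control input. -/
abbrev Step (𝒳 𝒵 𝒴 𝒰 : Type*) := ((𝒳 × 𝒵) × 𝒴) × 𝒰

/-- A cloud control loop with an output privacy filter over the horizon `T`. The time index
`t : Fin T` stands for time `t + 1`. The state and the measurement may depend on the past of the
plant (Markovian state-space plants and memoryless sensors are special cases; at the first time
the plant kernel is the initial law); the filter and the controller are randomized policies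
`P(y_t | y^{t-1}, u^{t-1}, z^t)` and `P(u_t | y^t, u^{t-1})`. The cloud sees only `Y` and `U`,
and its input is applied to the plant directly. -/
structure Loop (𝒳 𝒵 𝒴 𝒰 : Type*) [MeasurableSpace 𝒳] [MeasurableSpace 𝒵] [MeasurableSpace 𝒴]
    [MeasurableSpace 𝒰] (T : ℕ) where
  plant : (t : Fin T) → Kernel ((Fin t → 𝒳) × (Fin t → 𝒰)) 𝒳
  sensor : (t : Fin T) → Kernel ((Fin (t + 1) → 𝒳) × (Fin t → 𝒰)) 𝒵
  filter : (t : Fin T) → Kernel ((Fin t → 𝒴) × (Fin t → 𝒰) × (Fin (t + 1) → 𝒵)) 𝒴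
  controller : (t : Fin T) → Kernel ((Fin (t + 1) → 𝒴) × (Fin t → 𝒰)) 𝒰
  plant_markov : ∀ t, IsMarkovKernel (plant t)
  sensor_markov : ∀ t, IsMarkovKernel (sensor t)
  filter_markov : ∀ t, IsMarkovKernel (filter t)
  controller_markov : ∀ t, IsMarkovKernel (controller t)

section LoopLaw

lemma measurable_snoc {α : Type*} [MeasurableSpace α] (n : ℕ) :
    Measurable (fun p : (Fin n → α) × α => (Fin.snoc p.1 p.2 : Fin (n + 1) → α)) := by
  refine measurable_pi_lambda _ fun i => ?_
  refine Fin.lastCases ?_ (fun j => ?_) i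
  · simpa using measurable_snd
  · simpa using (show Measurable fun p : (Fin n → α) × α => p.1 j by fun_prop)

variable {𝒳 𝒵 𝒴 𝒰 : Type*} [MeasurableSpace 𝒳] [MeasurableSpace 𝒵] [MeasurableSpace 𝒴]
  [MeasurableSpace 𝒰] {T : ℕ}

namespace Loop

/-- The conditional law of the next step given all past steps. -/
def stepKernel (S : Loop 𝒳 𝒵 𝒴 𝒰 T) (t : Fin T) :
    Kernel (Fin t → Step 𝒳 𝒵 𝒴 𝒰) (Step 𝒳 𝒵 𝒴 𝒰) :=
  (((S.plant t).comap
      (fun w : Fin t → Step 𝒳 𝒵 𝒴 𝒰 => ((fun i => (w i).1.1.1), (fun i => (w i).2)))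
      (by fun_prop)
    ⊗ₖ (S.sensor t).comap
      (fun p : (Fin t → Step 𝒳 𝒵 𝒴 𝒰) × 𝒳 =>
        ((Fin.snoc (fun i => (p.1 i).1.1.1) p.2 : Fin (t + 1) → 𝒳), (fun i => (p.1 i).2)))
      (((measurable_snoc (t : ℕ)).comp
        (f := fun p : (Fin t → Step 𝒳 𝒵 𝒴 𝒰) × 𝒳 => ((fun i => (p.1 i).1.1.1), p.2))
        (by fun_prop)).prodMk (by fun_prop)))
    ⊗ₖ (S.filter t).comap
      (fun p : (Fin t → Step 𝒳 𝒵 𝒴 𝒰) × (𝒳 × 𝒵) =>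
        ((fun i => (p.1 i).1.2), (fun i => (p.1 i).2),
          (Fin.snoc (fun i => (p.1 i).1.1.2) p.2.2 : Fin (t + 1) → 𝒵)))
      (Measurable.prodMk (by fun_prop) (Measurable.prodMk (by fun_prop)
        ((measurable_snoc (t : ℕ)).comp
          (f := fun p : (Fin t → Step 𝒳 𝒵 𝒴 𝒰) × (𝒳 × 𝒵) =>
            ((fun i => (p.1 i).1.1.2), p.2.2))
          (by fun_prop)))))
    ⊗ₖ (S.controller t).comap
      (fun p : (Fin t → Step 𝒳 𝒵 𝒴 𝒰) × ((𝒳 × 𝒵) × 𝒴) =>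
        ((Fin.snoc (fun i => (p.1 i).1.2) p.2.2 : Fin (t + 1) → 𝒴), (fun i => (p.1 i).2)))
      (((measurable_snoc (t : ℕ)).comp
        (f := fun p : (Fin t → Step 𝒳 𝒵 𝒴 𝒰) × ((𝒳 × 𝒵) × 𝒴) =>
          ((fun i => (p.1 i).1.2), p.2.2))
        (by fun_prop)).prodMk (by fun_prop))

instance stepKernel_markov (S : Loop 𝒳 𝒵 𝒴 𝒰 T) (t : Fin T) :
    IsMarkovKernel (S.stepKernel t) := by
  have h1 := S.plant_markov t
  have h2 := S.sensor_markov t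
  have h3 := S.filter_markov t
  have h4 := S.controller_markov t
  unfold stepKernel
  infer_instance

/-- The joint law of the first `n` steps of the loop. -/
def lawUpTo (S : Loop 𝒳 𝒵 𝒴 𝒰 T) : (n : ℕ) → n ≤ T → Measure (Fin n → Step 𝒳 𝒵 𝒴 𝒰)
  | 0, _ => Measure.dirac Fin.elim0
  | n + 1, h => (S.lawUpTo n (Nat.le_of_succ_le h) ⊗ₘ S.stepKernel ⟨n, h⟩).map
      (fun p => (Fin.snoc p.1 p.2 : Fin (n + 1) → Step 𝒳 𝒵 𝒴 𝒰))

instance (S : Loop 𝒳 𝒵 𝒴 𝒰 T) (n : ℕ) (h : n ≤ T) : IsProbabilityMeasure (S.lawUpTo n h) := by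
  induction n with
  | zero => unfold lawUpTo; infer_instance
  | succ n ih =>
    have := ih (Nat.le_of_succ_le h)
    have : IsMarkovKernel (α := Fin n → Step 𝒳 𝒵 𝒴 𝒰) (S.stepKernel ⟨n, h⟩) :=
      S.stepKernel_markov ⟨n, h⟩
    unfold lawUpTo
    exact Measure.isProbabilityMeasure_map (measurable_snoc n).aemeasurable

/-- The joint law of `(X^T, Z^T, Y^T, U^T)`. -/
def law (S : Loop 𝒳 𝒵 𝒴 𝒰 T) : Measure (Fin T → Step 𝒳 𝒵 𝒴 𝒰) := S.lawUpTo T le_rfl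

instance (S : Loop 𝒳 𝒵 𝒴 𝒰 T) : IsProbabilityMeasure S.law := by
  unfold law; infer_instance

end Loop

/-- The private variable `X^t` at time `t`. -/
def privateVar (t : Fin T) (w : Fin T → Step 𝒳 𝒵 𝒴 𝒰) : Fin (t + 1) → 𝒳 :=
  fun i => (w ⟨i, by omega⟩).1.1.1

/-- The public variable `(Y^{t-1}, U^{t-1})` at time `t`. -/
def publicVar (t : Fin T) (w : Fin T → Step 𝒳 𝒵 𝒴 𝒰) : (Fin t → 𝒴) × (Fin t → 𝒰) :=
  ((fun i => (w ⟨i, by omega⟩).1.2), (fun i => (w ⟨i, by omega⟩).2))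

/-- The disclosed variable `Y_t` at time `t`. -/
def disclosedVar (t : Fin T) (w : Fin T → Step 𝒳 𝒵 𝒴 𝒰) : 𝒴 := (w t).1.2

variable [Fintype 𝒳] [Nonempty 𝒳] [DiscreteMeasurableSpace 𝒳] [StandardBorelSpace 𝒴] [Nonempty 𝒴]

namespace Loop

/-- The law `P_{Y^{t-1},U^{t-1}}`. -/
def publicLaw (S : Loop 𝒳 𝒵 𝒴 𝒰 T) (t : Fin T) : Measure ((Fin t → 𝒴) × (Fin t → 𝒰)) :=
  S.law.map (publicVar t)

/-- The conditional law `P_{X^t,Y_t | y^{t-1},u^{t-1}}`. -/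
def stageLaw (S : Loop 𝒳 𝒵 𝒴 𝒰 T) (t : Fin T) (h : (Fin t → 𝒴) × (Fin t → 𝒰)) :
    ProbabilityMeasure ((Fin (t + 1) → 𝒳) × 𝒴) :=
  ⟨condDistrib (fun w => (privateVar t w, disclosedVar t w)) (publicVar t) S.law h, inferInstance⟩

/-- `I(X^t; Y_t | Y^{t-1}, U^{t-1})`. -/
def stageInfo (S : Loop 𝒳 𝒵 𝒴 𝒰 T) (t : Fin T) : ℝ≥0∞ :=
  ∫⁻ h, mutualInfo (S.stageLaw t h) ∂(S.publicLaw t)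

/-- Kramer's causally conditioned directed information
`I(X^T → Y^T ‖ U^{T-1}) = ∑_t I(X^t; Y_t | Y^{t-1}, U^{t-1})`. -/
def directedInfo (S : Loop 𝒳 𝒵 𝒴 𝒰 T) : ℝ≥0∞ := ∑ t : Fin T, S.stageInfo t

/-- Expected instantaneous privacy loss at time `t`: with `X^t` private (represented as the
`𝒜`-valued variable `e(X^t)`) and `(Y^{t-1}, U^{t-1})` public, the expectation over the public
variable of the leakage `L` of the conditional law of `(X^t, Y_t)`. -/
def expectedStageLoss (S : Loop 𝒳 𝒵 𝒴 𝒰 T) (t : Fin T) {𝒜 : Type*} [MeasurableSpace 𝒜]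
    (L : ProbabilityMeasure (𝒜 × 𝒴) → ℝ) (e : (Fin (t + 1) → 𝒳) → 𝒜) : ℝ :=
  ∫ h, L (mapPrivate e (S.stageLaw t h)) ∂(S.publicLaw t)

end Loop

end LoopLaw

/-! ### Multi-stage privacy measures -/

/-- The alphabet `𝒳^1 ⊔ ⋯ ⊔ 𝒳^T` of all state histories up to the horizon, in which every private
variable `X^t` takes its values. -/
abbrev History (𝒳 : Type*) (T : ℕ) := Σ t : Fin T, (Fin (t + 1) → 𝒳)

/-- A state history of length `t` as an element of the common alphabet. -/
def toHistory {𝒳 : Type*} {T : ℕ} (t : Fin T) (x : Fin (t + 1) → 𝒳) : History 𝒳 T := ⟨t, x⟩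

instance {𝒳 : Type*} [MeasurableSpace 𝒳] [Fintype 𝒳] [DiscreteMeasurableSpace 𝒳] (T : ℕ) :
    DiscreteMeasurableSpace (History 𝒳 T) where
  forall_measurableSet s := by
    refine MeasurableSpace.measurableSet_iInf.2 fun t => ?_
    exact MeasurableSet.of_discrete (s := Sigma.mk t ⁻¹' s)

section Postulates

variable {𝒳 𝒵 𝒴 𝒰 : Type*} [MeasurableSpace 𝒳] [MeasurableSpace 𝒵] [MeasurableSpace 𝒴]
  [MeasurableSpace 𝒰] {T : ℕ}
  [Fintype 𝒳] [Nonempty 𝒳] [DiscreteMeasurableSpace 𝒳] [StandardBorelSpace 𝒴] [Nonempty 𝒴]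

/-- The four postulates for a measure `J` of the expected total privacy loss: for one loss
function `ℓ` on the alphabet of state histories, with its Bayes-envelope leakage function `L`
obeying the data-processing axiom, `J` is the sum over the stages of the expected instantaneous
losses, `X^t` being private and `(Y^{t-1}, U^{t-1})` public at time `t`. -/
def SatisfiesPostulates (J : Loop 𝒳 𝒵 𝒴 𝒰 T → ℝ) : Prop :=
  ∃ (ℓ : History 𝒳 T → ProbabilityMeasure (History 𝒳 T) → EReal)
    (L : ProbabilityMeasure (History 𝒳 T × 𝒴) → ℝ),
    IsPrivacyLeakage ℓ L ∧
    ∀ S : Loop 𝒳 𝒵 𝒴 𝒰 T, J S = ∑ t : Fin T, S.expectedStageLoss t L (toHistory t)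

/-- The same postulates with an unrelated loss function `ℓ_t` on `𝒳^t` for every stage `t`. -/
def SatisfiesStagewisePostulates (J : Loop 𝒳 𝒵 𝒴 𝒰 T → ℝ) : Prop :=
  ∃ (ℓ : (t : Fin T) → (Fin (t + 1) → 𝒳) → ProbabilityMeasure (Fin (t + 1) → 𝒳) → EReal)
    (L : (t : Fin T) → ProbabilityMeasure ((Fin (t + 1) → 𝒳) × 𝒴) → ℝ),
    (∀ t, IsPrivacyLeakage (ℓ t) (L t)) ∧
    ∀ S : Loop 𝒳 𝒵 𝒴 𝒰 T, J S = ∑ t : Fin T, S.expectedStageLoss t (L t) id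

end Postulates

end CloudPrivacy

end

/-! Write `V` for the Bayes envelope as a function of the law. As an infimum of functions linear in
the law, `V` is concave. A binary disclosure, under which `X` has law `p` or `q` according to the
value of `Y`, has as its leakage the concavity gap of `V` at the mixture (`envelopeDrop_binaryLaw`).
Let one value of `Y` force `X = a` and let the other leave `X` with a law `p` off `a`. Once it is
known whether `X = a`, the remaining detail of `X` says nothing about `Y`, so all letters other than
`a` may be merged into a single letter `b`. The data-processing axiom then makes the gap independent
of `p` (`concavityGap_merge`), hence a function `H` of the weight alone.

Peeling the letters of a three-point law in two different orders yields the fundamental equation of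
information theory for `H`. Its concave solutions vanishing at 0 and 1 are `c * binEntropy` with `0
≤ c` (`eq_mul_binEntropy_of_fundamental_equation`). Peeling all letters of a general law gives `V` =
affine + `c * entropy` (`eq_affine_add_mul_entropy`). The affine part cancels in the leakage, and
what is left is `c` times mutual information (`IsPrivacyLeakage.exists_eq_mul_entropyDrop`). With
only two letters the merging is a relabelling and carries no information, hence the bound on the
alphabet.

Averaging over the public variable and summing over the stages gives the multi-stage claims. A
common loss function gives one constant for all stages, because each `X^t` embeds injectively into
the alphabet of histories and an injective relabelling preserves information. Conversely, the
logarithmic loss has the entropy as its envelope, by Gibbs' inequality, and the entropy chain rule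
gives invariance under sufficient statistics (`entropyDrop_mapPrivate`). -/

noncomputable section

set_option linter.unusedSectionVars false

namespace CloudPrivacy

/-! ### The fundamental equation of information theory -/

section FunctionalEquation

open Real

/-- A monotone completely additive function on the positive integers is a multiple of the
logarithm. -/
lemma eq_mul_log_of_monotone_of_additive {g : ℕ → ℝ}
    (hmono : ∀ m n, 1 ≤ m → m ≤ n → g m ≤ g n)
    (hadd : ∀ m n, 1 ≤ m → 1 ≤ n → g (m * n) = g m + g n) :
    ∃ c : ℝ, 0 ≤ c ∧ ∀ n, 1 ≤ n → g n = c * log n := by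
  have h1 : g 1 = 0 := by
    have := hadd 1 1 le_rfl le_rfl
    simp at this
    exact this
  have h2 : 0 ≤ g 2 := h1 ▸ hmono 1 2 le_rfl (by norm_num)
  have hpow : ∀ n, 1 ≤ n → ∀ m : ℕ, g (n ^ m) = m * g n := by
    intro n hn m
    induction m with
    | zero => simp [h1]
    | succ m ih =>
      rw [pow_succ, hadd _ _ (Nat.one_le_pow _ _ hn) hn, ih]
      push_cast; ring
  have hlog2 : 0 < log 2 := log_pos one_lt_two
  refine ⟨g 2 / log 2, by positivity, fun n hn => ?_⟩
  have hc : g 2 / log 2 * log 2 = g 2 := by field_simp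
  set c := g 2 / log 2 with hcdef
  have hc0 : 0 ≤ c := by positivity
  -- With `2 ^ k ≤ n ^ m ≤ 2 ^ (k + 1)`, both `m * g n` and `c * m * log n` lie between `k * g 2`
  -- and `(k + 1) * g 2`. The bound on their difference does not depend on `m`, so `g n - c * log n`
  -- must vanish.
  have key : ∀ m : ℕ, |(m : ℝ) * (g n - c * log n)| ≤ g 2 := by
    intro m
    have hpos : n ^ m ≠ 0 := by positivity
    set k := Nat.log 2 (n ^ m) with hk
    have hlo : 2 ^ k ≤ n ^ m := Nat.pow_log_le_self 2 hpos
    have hhi : n ^ m ≤ 2 ^ (k + 1) := (Nat.lt_pow_succ_log_self one_lt_two _).le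
    have g1 := hmono _ _ (Nat.one_le_two_pow) hlo
    have g2 := hmono _ _ (Nat.one_le_pow _ _ hn) hhi
    rw [hpow _ one_le_two, hpow _ hn] at g1
    rw [hpow _ one_le_two, hpow _ hn] at g2
    have hlo' : (2 : ℝ) ^ k ≤ (n : ℝ) ^ m := by exact_mod_cast hlo
    have hhi' : (n : ℝ) ^ m ≤ (2 : ℝ) ^ (k + 1) := by exact_mod_cast hhi
    have hnpos : (0 : ℝ) < (n : ℝ) ^ m := by positivity
    have l1 := log_le_log (by positivity) hlo'
    have l2 := log_le_log hnpos hhi'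
    rw [log_pow, log_pow] at l1 l2
    have l1' := mul_le_mul_of_nonneg_left l1 hc0
    have l2' := mul_le_mul_of_nonneg_left l2 hc0
    push_cast at g1 g2 l1' l2'
    have e1 : c * ((k : ℝ) * log 2) = k * g 2 := by rw [← hc]; ring
    have e2 : c * (((k : ℝ) + 1) * log 2) = (k + 1) * g 2 := by rw [← hc]; ring
    rw [e1] at l1'
    rw [e2] at l2'
    rw [abs_le]
    constructor <;> linarith
  by_contra hne
  have hpos : 0 < |g n - c * log n| := abs_pos.2 (sub_ne_zero.2 hne)
  obtain ⟨m, hm⟩ := exists_nat_gt (g 2 / |g n - c * log n|)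
  have := key m
  rw [abs_mul, Nat.abs_cast] at this
  rw [div_lt_iff₀ hpos] at hm
  linarith

variable {h : ℝ → ℝ}

/-- Concave solutions of the fundamental equation of information theory that vanish at the end
points are multiples of the binary entropy. -/
theorem eq_mul_binEntropy_of_fundamental_equation
    (hconc : ConcaveOn ℝ (Set.Icc 0 1) h) (h0 : h 0 = 0) (h1 : h 1 = 0)
    (hsymm : ∀ x ∈ Set.Icc (0 : ℝ) 1, h (1 - x) = h x)
    (hfund : ∀ x y, 0 < x → 0 < y → x + y < 1 →
      h x + (1 - x) * h (y / (1 - x)) = h y + (1 - y) * h (x / (1 - y))) :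
    ∃ c : ℝ, 0 ≤ c ∧ ∀ x ∈ Set.Icc (0 : ℝ) 1, h x = c * binEntropy x := by
  -- `G x y` is the homogeneous form of `h`: the uncertainty in splitting a mass `x + y` into `x`
  -- and `y`. In these terms the fundamental equation is the cocycle identity `Gcoc`.
  set G : ℝ → ℝ → ℝ := fun x y => (x + y) * h (x / (x + y)) with hG
  have Gsymm : ∀ x y, 0 < x → 0 < y → G x y = G y x := by
    intro x y hx hy
    simp only [hG]
    rw [add_comm y x, ← hsymm (x / (x + y)) ⟨by positivity, by
      rw [div_le_one (by positivity)]; linarith⟩]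
    congr 2
    field_simp
    ring
  have Ghom : ∀ k x y, 0 < k → G (k * x) (k * y) = k * G x y := by
    intro k x y hk
    simp only [hG]
    rw [← mul_add, mul_div_mul_left _ _ hk.ne']
    ring
  have Gcoc : ∀ x y z, 0 < x → 0 < y → 0 < z → G x y + G (x + y) z = G y z + G x (y + z) := by
    intro x y z hx hy hz
    have hS : 0 < x + y + z := by positivity
    have := hfund (x / (x + y + z)) (z / (x + y + z)) (by positivity) (by positivity) (by
      rw [← add_div, div_lt_one hS]; linarith)
    have e1 : 1 - x / (x + y + z) = (z + y) / (x + y + z) := by field_simp; ring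
    have e2 : 1 - z / (x + y + z) = (x + y) / (x + y + z) := by field_simp; ring
    rw [e1, e2, div_div_div_cancel_right₀ hS.ne', div_div_div_cancel_right₀ hS.ne'] at this
    rw [Gsymm (x + y) z (by positivity) hz, Gsymm y z hy hz]
    simp only [hG]
    rw [show z + (x + y) = x + y + z by ring, show x + (y + z) = x + y + z by ring]
    field_simp at this
    linarith
  -- By symmetry `G k 1 = (1 + k) * h (1 / (1 + k))` for positive `k`, the slope of the chord of `h`
  -- from 0, which increases with `k` by concavity and `h 0 = 0`. For `k = 0` symmetry is not
  -- available, and `0 ≤ h (1 / 2)` is used instead.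
  have Gmono : ∀ m n : ℕ, m ≤ n → G m 1 ≤ G n 1 := by
    refine fun m n hmn => monotone_nat_of_le_succ (f := fun m : ℕ => G m 1) (fun k => ?_) hmn
    rcases Nat.eq_zero_or_pos k with rfl | hk
    · have hh : 0 ≤ h (1 / 2) := by
        have := hconc.2 (Set.left_mem_Icc.2 zero_le_one) (Set.right_mem_Icc.2 zero_le_one)
          (show (0 : ℝ) ≤ 1 / 2 by norm_num) (show (0 : ℝ) ≤ 1 / 2 by norm_num) (by norm_num)
        simpa [h0, h1] using this
      simp only [hG]
      norm_num [h0]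
      norm_num at hh
      exact hh
    · have hk' : (0 : ℝ) < k := by exact_mod_cast hk
      show G k 1 ≤ G ((k + 1 : ℕ) : ℝ) 1
      rw [Gsymm _ _ hk' one_pos, Gsymm _ _ (by positivity) one_pos]
      simp only [hG]
      push_cast
      have := hconc.2 (Set.left_mem_Icc.2 zero_le_one)
        (show 1 / (1 + (k : ℝ)) ∈ Set.Icc 0 1 from
          ⟨by positivity, by rw [div_le_one (by positivity)]; linarith⟩)
        (show 0 ≤ 1 / (1 + ((k : ℝ) + 1)) by positivity)
        (show 0 ≤ (1 + (k : ℝ)) / (1 + (k + 1)) by positivity) (by field_simp; ring)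
      simp only [h0, smul_eq_mul, mul_zero, zero_add] at this
      have e : (1 + (k : ℝ)) / (1 + (k + 1)) * (1 / (1 + k)) = 1 / (1 + (k + 1)) := by field_simp
      rw [e, div_mul_eq_mul_div, div_le_iff₀ (by positivity)] at this
      linarith
  -- On positive integers the cocycle is a coboundary, `G m n = φ (m + n) - φ m - φ n`. Homogeneity
  -- makes `φ n / n` completely additive and `Gmono` makes it monotone, so `φ n = c * n * log n`.
  set φ : ℕ → ℝ := fun n => ∑ k ∈ Finset.range n, G k 1 with hφ
  have G01 : G 0 1 = 0 := by simp [hG, h0]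
  have φ1 : φ 1 = 0 := by simp [hφ, G01]
  have φsucc : ∀ n, φ (n + 1) = φ n + G n 1 := fun n => Finset.sum_range_succ _ _
  have φadd : ∀ m n : ℕ, 1 ≤ m → 1 ≤ n → φ (m + n) = φ m + φ n + G m n := by
    intro m n hm hn
    induction n, hn using Nat.le_induction with
    | base => rw [φsucc, φ1, Nat.cast_one]; ring
    | succ n hn ih =>
      rw [← add_assoc, φsucc, ih, φsucc]
      have := Gcoc m n 1 (by exact_mod_cast hm) (by exact_mod_cast hn) one_pos
      push_cast
      linarith
  have φmul : ∀ k m : ℕ, 1 ≤ k → 1 ≤ m → φ (k * m) = k * φ m + m * φ k := by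
    intro k m hk hm
    induction m, hm using Nat.le_induction with
    | base => simp [φ1]
    | succ m hm ih =>
      have hk' : (0 : ℝ) < k := by exact_mod_cast hk
      have := Ghom k m 1 hk'
      rw [mul_one] at this
      rw [mul_add, mul_one, φadd _ _ (Nat.mul_pos hk hm) hk, ih, φsucc]
      push_cast
      rw [this]
      ring
  have φle : ∀ n, φ n ≤ n * G n 1 := by
    intro n
    simp only [hφ]
    refine (Finset.sum_le_card_nsmul _ _ (G n 1) fun k hk => ?_).trans_eq (by simp)
    exact Gmono _ _ (Finset.mem_range.1 hk).le
  obtain ⟨c, hc0, hc⟩ := eq_mul_log_of_monotone_of_additive (g := fun n => φ n / n) (by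
      intro m n hm hmn
      induction n, hmn using Nat.le_induction with
      | base => exact le_rfl
      | succ n hn ih =>
        refine ih.trans ?_
        have hn' : (0 : ℝ) < n := by exact_mod_cast hm.trans hn
        rw [φsucc, div_le_div_iff₀ hn' (by positivity)]
        have := φle n
        push_cast
        linarith) (by
      intro m n hm hn
      have hm' : (0 : ℝ) < m := by exact_mod_cast hm
      have hn' : (0 : ℝ) < n := by exact_mod_cast hn
      rw [φmul m n hm hn]
      push_cast
      field_simp
      ring)
  have φeq : ∀ n : ℕ, 1 ≤ n → φ n = c * (n * log n) := by
    intro n hn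
    have hn' : (0 : ℝ) < n := by exact_mod_cast hn
    have := hc n hn
    field_simp at this
    linarith
  have hrat : ∀ m n : ℕ, 1 ≤ m → 1 ≤ n →
      h (m / (m + n)) = c * binEntropy (m / (m + n)) := by
    intro m n hm hn
    have hm' : (0 : ℝ) < m := by exact_mod_cast hm
    have hn' : (0 : ℝ) < n := by exact_mod_cast hn
    have := φadd m n hm hn
    rw [φeq m hm, φeq n hn, φeq (m + n) (by omega)] at this
    simp only [hG] at this
    push_cast at this
    have e : 1 - (m : ℝ) / (m + n) = n / (m + n) := by field_simp; ring
    rw [binEntropy_eq_negMulLog_add_negMulLog_one_sub, e]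
    simp only [negMulLog]
    rw [log_div hm'.ne' (by positivity), log_div hn'.ne' (by positivity)]
    field_simp
    linarith
  refine ⟨c, hc0, ?_⟩
  -- Concavity gives continuity in the interior only, which suffices to pass from rational points to
  -- the open interval. The end points are covered by `h0` and `h1`.
  have hcont : ContinuousOn h (Set.Ioo 0 1) :=
    (hconc.subset Set.Ioo_subset_Icc_self (convex_Ioo 0 1)).continuousOn isOpen_Ioo
  have hIoo : ∀ x ∈ Set.Ioo (0 : ℝ) 1, h x = c * binEntropy x := by
    have hdense : Set.Ioo (0 : ℝ) 1 ⊆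
        closure (Set.Ioo (0 : ℝ) 1 ∩ Set.range ((↑) : ℚ → ℝ)) :=
      Dense.open_subset_closure_inter Rat.denseRange_cast isOpen_Ioo
    refine fun x hx => Set.EqOn.of_subset_closure (s := Set.Ioo (0 : ℝ) 1 ∩ Set.range ((↑) : ℚ → ℝ))
      ?_ hcont ((continuous_const.mul binEntropy_continuous).continuousOn)
      Set.inter_subset_left hdense hx
    rintro _ ⟨⟨hq0, hq1⟩, q, rfl⟩
    have hq0' : 0 < q := by exact_mod_cast hq0
    have hq1' : q < 1 := by exact_mod_cast hq1
    have hnum : 0 < q.num := Rat.num_pos.2 hq0'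
    have hlt : q.num < q.den := Rat.num_lt_denom_iff.2 hq1'
    obtain ⟨m, hm⟩ := Int.eq_ofNat_of_zero_le hnum.le
    obtain ⟨n, hn⟩ := Nat.exists_eq_add_of_le (show m ≤ q.den by omega)
    have := hrat m n (by omega) (by omega)
    have hq : (q : ℝ) = m / (m + n) := by
      rw [Rat.cast_def, hm, hn]
      push_cast
      rfl
    simp only [hq]
    exact this
  intro x hx
  rcases hx.1.eq_or_lt with rfl | hx0
  · simp [h0]
  rcases hx.2.eq_or_lt with rfl | hx1
  · simp [h1]
  exact hIoo x ⟨hx0, hx1⟩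

end FunctionalEquation

/-! ### Posterior laws and entropy -/

section Posterior

open Real

variable {𝒜 𝒴 : Type*} [Fintype 𝒜] [MeasurableSpace 𝒜] [DiscreteMeasurableSpace 𝒜]
  [MeasurableSpace 𝒴]

lemma ext_singleton_prod {μ ν : Measure (𝒜 × 𝒴)}
    (h : ∀ x B, MeasurableSet B → μ ({x} ×ˢ B) = ν ({x} ×ˢ B)) : μ = ν := by
  ext E hE
  have hdec : E = ⋃ x : 𝒜, {x} ×ˢ (Prod.mk x ⁻¹' E) := by
    ext ⟨x, y⟩
    simp
  have hm : ∀ x : 𝒜, MeasurableSet (Prod.mk x ⁻¹' E) := fun x => measurable_prodMk_left hE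
  have hd : Pairwise (Function.onFun Disjoint fun x : 𝒜 => {x} ×ˢ (Prod.mk x ⁻¹' E)) := by
    intro x x' hx
    exact Set.disjoint_prod.2 (Or.inl (by simpa using hx))
  rw [hdec, measure_iUnion hd fun x => (measurableSet_singleton x).prod (hm x),
    measure_iUnion hd fun x => (measurableSet_singleton x).prod (hm x)]
  exact tsum_congr fun x => h x _ (hm x)

lemma exists_kernel_posterior (P : ProbabilityMeasure (𝒜 × 𝒴)) :
    ∃ κ : Kernel 𝒴 𝒜, IsMarkovKernel κ ∧
      (P : Measure (𝒜 × 𝒴)).snd ⊗ₘ κ = (P : Measure (𝒜 × 𝒴)).map Prod.swap ∧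
      ∀ y, (posterior P y : Measure 𝒜) = κ y := by
  have : Nonempty 𝒜 := P.nonempty.map Prod.fst
  refine ⟨condDistrib Prod.fst Prod.snd (P : Measure (𝒜 × 𝒴)), inferInstance, ?_, fun y => rfl⟩
  exact compProd_map_condDistrib measurable_fst.aemeasurable

/-- Disintegrations are almost surely unique, so any Markov kernel that reproduces the joint law may
stand in for the posterior. -/
lemma posterior_ae_eq {P : ProbabilityMeasure (𝒜 × 𝒴)} {κ : Kernel 𝒴 𝒜} [IsMarkovKernel κ]
    (h : (P : Measure (𝒜 × 𝒴)).snd ⊗ₘ κ = (P : Measure (𝒜 × 𝒴)).map Prod.swap) :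
    ∀ᵐ y ∂(P : Measure (𝒜 × 𝒴)).snd, (posterior P y : Measure 𝒜) = κ y := by
  have : Nonempty 𝒜 := P.nonempty.map Prod.fst
  exact condDistrib_ae_eq_of_measure_eq_compProd (μ := (P : Measure (𝒜 × 𝒴))) Prod.snd
    measurable_fst.aemeasurable h.symm

lemma measurable_posterior (P : ProbabilityMeasure (𝒜 × 𝒴)) (s : Set 𝒜) :
    Measurable fun y => (posterior P y : Measure 𝒜) s := by
  obtain ⟨κ, _, -, hκ⟩ := exists_kernel_posterior P
  simp_rw [hκ]
  exact Kernel.measurable_coe κ (MeasurableSet.of_discrete)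

lemma measurable_posterior_real (P : ProbabilityMeasure (𝒜 × 𝒴)) (s : Set 𝒜) :
    Measurable fun y => (posterior P y : Measure 𝒜).real s :=
  (measurable_posterior P s).ennreal_toReal

lemma lintegral_posterior (P : ProbabilityMeasure (𝒜 × 𝒴)) (s : Set 𝒜) {B : Set 𝒴}
    (hB : MeasurableSet B) :
    ∫⁻ y in B, (posterior P y : Measure 𝒜) s ∂(P : Measure (𝒜 × 𝒴)).snd
      = (P : Measure (𝒜 × 𝒴)) (s ×ˢ B) := by
  obtain ⟨κ, _, hP, hκ⟩ := exists_kernel_posterior P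
  simp_rw [hκ]
  rw [← Measure.compProd_apply_prod hB (MeasurableSet.of_discrete), hP,
    Measure.map_apply measurable_swap (hB.prod MeasurableSet.of_discrete), Set.preimage_swap_prod]

lemma integrable_posterior (P : ProbabilityMeasure (𝒜 × 𝒴)) (s : Set 𝒜) :
    Integrable (fun y => (posterior P y : Measure 𝒜).real s) (P : Measure (𝒜 × 𝒴)).snd := by
  refine Integrable.of_bound (measurable_posterior_real P s).aestronglyMeasurable 1
    (ae_of_all _ fun y => ?_)
  rw [Real.norm_of_nonneg measureReal_nonneg]
  exact measureReal_le_one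

lemma setIntegral_posterior (P : ProbabilityMeasure (𝒜 × 𝒴)) (s : Set 𝒜) {B : Set 𝒴}
    (hB : MeasurableSet B) :
    ∫ y in B, (posterior P y : Measure 𝒜).real s ∂(P : Measure (𝒜 × 𝒴)).snd
      = (P : Measure (𝒜 × 𝒴)).real (s ×ˢ B) := by
  rw [measureReal_def, ← lintegral_posterior P s hB]
  exact integral_toReal (measurable_posterior P s).aemeasurable
    (ae_of_all _ fun y => measure_lt_top _ _)

lemma integral_posterior (P : ProbabilityMeasure (𝒜 × 𝒴)) (s : Set 𝒜) :
    ∫ y, (posterior P y : Measure 𝒜).real s ∂(P : Measure (𝒜 × 𝒴)).snd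
      = (P : Measure (𝒜 × 𝒴)).fst.real s := by
  rw [← setIntegral_univ, setIntegral_posterior P s MeasurableSet.univ, measureReal_def,
    measureReal_def, Measure.fst_apply MeasurableSet.of_discrete, Set.prod_univ]

lemma ae_posterior_eq_zero (P : ProbabilityMeasure (𝒜 × 𝒴)) {x : 𝒜}
    (hx : (P : Measure (𝒜 × 𝒴)).fst.real {x} = 0) :
    ∀ᵐ y ∂(P : Measure (𝒜 × 𝒴)).snd, (posterior P y : Measure 𝒜).real {x} = 0 := by
  have h := (integral_eq_zero_iff_of_nonneg (fun y => measureReal_nonneg)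
    (integrable_posterior P {x})).1 ((integral_posterior P {x}).trans hx)
  exact h

/-- Shannon's entropy of a law on a finite alphabet. -/
def entropy {𝒜 : Type*} [Fintype 𝒜] [MeasurableSpace 𝒜] (μ : Measure 𝒜) : ℝ :=
  ∑ x, negMulLog (μ.real {x})

lemma entropy_nonneg (μ : Measure 𝒜) [IsProbabilityMeasure μ] : 0 ≤ entropy μ :=
  Finset.sum_nonneg fun _ _ => negMulLog_nonneg measureReal_nonneg measureReal_le_one

lemma entropy_le_card (μ : Measure 𝒜) : entropy μ ≤ Fintype.card 𝒜 := by
  refine (Finset.sum_le_card_nsmul _ _ 1 fun x _ => ?_).trans_eq (by simp)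
  have := negMulLog_le_one_sub_self (x := μ.real {x}) measureReal_nonneg
  linarith [measureReal_nonneg (μ := μ) (s := {x})]

lemma sum_real_singleton (μ : Measure 𝒜) [IsProbabilityMeasure μ] :
    ∑ x, μ.real {x} = 1 := by
  rw [sum_measureReal_singleton]
  simp

lemma integrable_negMulLog_posterior (P : ProbabilityMeasure (𝒜 × 𝒴)) (s : Set 𝒜) :
    Integrable (fun y => negMulLog ((posterior P y : Measure 𝒜).real s))
      (P : Measure (𝒜 × 𝒴)).snd := by
  refine Integrable.of_bound
    (continuous_negMulLog.measurable.comp (measurable_posterior_real P s)).aestronglyMeasurable 1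
    (ae_of_all _ fun y => ?_)
  rw [Real.norm_of_nonneg (negMulLog_nonneg measureReal_nonneg measureReal_le_one)]
  have := negMulLog_le_one_sub_self (x := (posterior P y : Measure 𝒜).real s) measureReal_nonneg
  linarith [measureReal_nonneg (μ := (posterior P y : Measure 𝒜)) (s := s)]

lemma integrable_entropy_posterior (P : ProbabilityMeasure (𝒜 × 𝒴)) :
    Integrable (fun y => entropy (posterior P y : Measure 𝒜)) (P : Measure (𝒜 × 𝒴)).snd :=
  integrable_finsetSum _ fun x _ => integrable_negMulLog_posterior P {x}

/-- The expected decrease of the entropy of the private variable caused by the disclosure. -/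
def entropyDrop (P : ProbabilityMeasure (𝒜 × 𝒴)) : ℝ :=
  entropy (P : Measure (𝒜 × 𝒴)).fst
    - ∫ y, entropy (posterior P y : Measure 𝒜) ∂(P : Measure (𝒜 × 𝒴)).snd

lemma entropyDrop_le_card (P : ProbabilityMeasure (𝒜 × 𝒴)) :
    entropyDrop P ≤ Fintype.card 𝒜 := by
  have h1 := entropy_le_card (P : Measure (𝒜 × 𝒴)).fst
  have h2 : 0 ≤ ∫ y, entropy (posterior P y : Measure 𝒜) ∂(P : Measure (𝒜 × 𝒴)).snd :=
    integral_nonneg fun y => entropy_nonneg _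
  unfold entropyDrop
  linarith

/-- An affine term of the Bayes envelope does not contribute to its expected decrease. -/
lemma envelopeDrop_eq_mul_entropyDrop {ℓ : 𝒜 → ProbabilityMeasure 𝒜 → EReal} {a : 𝒜 → ℝ} {c : ℝ}
    (hV : ∀ p : ProbabilityMeasure 𝒜, (bayesEnvelope ℓ p).toReal
      = ∑ x, (p : Measure 𝒜).real {x} * a x + c * entropy (p : Measure 𝒜))
    (P : ProbabilityMeasure (𝒜 × 𝒴)) :
    envelopeDrop ℓ P = c * entropyDrop P := by
  have hlin : ∀ x ∈ Finset.univ, Integrable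
      (fun y => (posterior P y : Measure 𝒜).real {x} * a x) (P : Measure (𝒜 × 𝒴)).snd :=
    fun x _ => (integrable_posterior P {x}).mul_const _
  unfold envelopeDrop entropyDrop
  simp_rw [hV]
  rw [integral_add (integrable_finsetSum _ hlin) ((integrable_entropy_posterior P).const_mul c),
    integral_finsetSum _ hlin, integral_const_mul, ProbabilityMeasure.toMeasure_map]
  simp_rw [integral_mul_const, integral_posterior]
  simp only [Measure.fst]
  ring

/-- The density of a joint law with respect to the product of its marginals. -/
lemma eq_withDensity_posterior (P : ProbabilityMeasure (𝒜 × 𝒴)) :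
    (P : Measure (𝒜 × 𝒴)) =
      ((P : Measure (𝒜 × 𝒴)).fst.prod (P : Measure (𝒜 × 𝒴)).snd).withDensity
        (fun z => ENNReal.ofReal ((posterior P z.2 : Measure 𝒜).real {z.1}
          / (P : Measure (𝒜 × 𝒴)).fst.real {z.1})) := by
  have hmeas : Measurable (fun z : 𝒜 × 𝒴 => ENNReal.ofReal
      ((posterior P z.2 : Measure 𝒜).real {z.1} / (P : Measure (𝒜 × 𝒴)).fst.real {z.1})) :=
    measurable_from_prod_countable_right fun x =>
      ((measurable_posterior_real P {x}).div_const
        ((P : Measure (𝒜 × 𝒴)).fst.real {x})).ennreal_ofReal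
  refine ext_singleton_prod fun x B hB => ?_
  rw [withDensity_apply _ ((measurableSet_singleton x).prod hB), ← Measure.prod_restrict,
    lintegral_prod _ hmeas.aemeasurable, lintegral_singleton]
  -- At a letter of prior mass zero both sides vanish, so the value of the quotient by zero is
  -- immaterial.
  rcases eq_or_ne ((P : Measure (𝒜 × 𝒴)).fst {x}) 0 with h0 | h0
  · rw [h0, mul_zero]
    rw [Measure.fst_apply (measurableSet_singleton x)] at h0
    exact measure_mono_null (fun z hz => hz.1) h0
  · have htop : (P : Measure (𝒜 × 𝒴)).fst {x} ≠ ∞ := measure_ne_top _ _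
    have e : ∀ y, ENNReal.ofReal ((posterior P y : Measure 𝒜).real {x}
        / (P : Measure (𝒜 × 𝒴)).fst.real {x})
        = (posterior P y : Measure 𝒜) {x} / (P : Measure (𝒜 × 𝒴)).fst {x} := by
      intro y
      rw [measureReal_def, measureReal_def, ← ENNReal.toReal_div, ENNReal.ofReal_toReal]
      exact ENNReal.div_ne_top (measure_ne_top _ _) h0
    simp_rw [e, div_eq_mul_inv]
    rw [lintegral_mul_const _ (measurable_posterior P {x}), lintegral_posterior P {x} hB, mul_assoc,
      ENNReal.inv_mul_cancel h0 htop, mul_one]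

/-- For a finite private alphabet mutual information is finite and is the expected decrease of
the entropy. -/
theorem mutualInfo_eq_ofReal_and_entropyDrop_nonneg (P : ProbabilityMeasure (𝒜 × 𝒴)) :
    mutualInfo P = ENNReal.ofReal (entropyDrop P) ∧ 0 ≤ entropyDrop P := by
  set ν := (P : Measure (𝒜 × 𝒴)).snd with hν
  set p := (P : Measure (𝒜 × 𝒴)).fst with hp
  set f : 𝒜 × 𝒴 → ℝ := fun z => (posterior P z.2 : Measure 𝒜).real {z.1} / p.real {z.1} with hf
  have hP : (P : Measure (𝒜 × 𝒴)) = (p.prod ν).withDensity fun z => ENNReal.ofReal (f z) :=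
    eq_withDensity_posterior P
  have hfm : Measurable f := measurable_from_prod_countable_right fun x =>
    (measurable_posterior_real P {x}).div_const (p.real {x})
  have hac : (P : Measure (𝒜 × 𝒴)) ≪ p.prod ν := by
    rw [hP]; exact withDensity_absolutelyContinuous _ _
  have hf0 : ∀ z, 0 ≤ f z := fun z => div_nonneg measureReal_nonneg measureReal_nonneg
  have hrn : (fun z => InformationTheory.klFun ((P : Measure (𝒜 × 𝒴)).rnDeriv (p.prod ν) z).toReal)
      =ᵐ[p.prod ν] fun z => InformationTheory.klFun (f z) := by
    have := Measure.rnDeriv_withDensity (p.prod ν) hfm.ennreal_ofReal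
    rw [← hP] at this
    filter_upwards [this] with z hz
    rw [hz, ENNReal.toReal_ofReal (hf0 z)]
  -- The density is at most the inverse prior mass of the letter, and there are finitely many
  -- letters. This boundedness makes `klFun ∘ f` integrable.
  obtain ⟨M, hM⟩ : ∃ M, ∀ z, f z ≤ M := by
    refine ⟨∑ x, 1 / p.real {x}, fun z => ?_⟩
    refine le_trans ?_ (Finset.single_le_sum (f := fun x => 1 / p.real {x})
      (fun x _ => by positivity) (Finset.mem_univ z.1))
    exact div_le_div_of_nonneg_right measureReal_le_one measureReal_nonneg
  obtain ⟨C, hC⟩ := isCompact_Icc.exists_bound_of_continuousOn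
    (InformationTheory.continuous_klFun.continuousOn (s := Set.Icc 0 M))
  have hint : Integrable (fun z => InformationTheory.klFun (f z)) (p.prod ν) :=
    Integrable.of_bound (InformationTheory.measurable_klFun.comp hfm).aestronglyMeasurable C
      (ae_of_all _ fun z => hC _ ⟨hf0 z, hM z⟩)
  have hkl : mutualInfo P = ENNReal.ofReal (∫ z, InformationTheory.klFun (f z) ∂(p.prod ν)) := by
    rw [mutualInfo, InformationTheory.klDiv_eq_lintegral_klFun_of_ac hac,
      ofReal_integral_eq_lintegral_ofReal hint
        (ae_of_all _ fun z => InformationTheory.klFun_nonneg (hf0 z))]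
    refine lintegral_congr_ae ?_
    filter_upwards [hrn] with z hz
    rw [hz]
  suffices hdrop : ∫ z, InformationTheory.klFun (f z) ∂(p.prod ν) = entropyDrop P by
    rw [hkl, ← hdrop]
    exact ⟨rfl, integral_nonneg fun z => InformationTheory.klFun_nonneg (hf0 z)⟩
  rw [integral_prod _ hint, integral_fintype (Integrable.of_finite)]
  -- Expanding `klFun`, the terms linear in the posterior integrate to multiples of the prior mass,
  -- because the posterior averages to the prior; only the two `negMulLog` terms survive.
  have hterm : ∀ x, p.real {x} • ∫ y, InformationTheory.klFun (f (x, y)) ∂ν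
      = negMulLog (p.real {x}) - ∫ y, negMulLog ((posterior P y : Measure 𝒜).real {x}) ∂ν := by
    intro x
    rw [smul_eq_mul, ← integral_const_mul]
    have hpt : ∀ᵐ y ∂ν, p.real {x} * InformationTheory.klFun (f (x, y))
        = (p.real {x} - (posterior P y : Measure 𝒜).real {x} * (log (p.real {x}) + 1))
          - negMulLog ((posterior P y : Measure 𝒜).real {x}) := by
      rcases eq_or_ne (p.real {x}) 0 with h0 | h0
      · filter_upwards [ae_posterior_eq_zero P h0] with y hy
        simp [h0, hy]
      · refine ae_of_all _ fun y => ?_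
        simp only [hf, InformationTheory.klFun, negMulLog]
        rcases eq_or_ne ((posterior P y : Measure 𝒜).real {x}) 0 with h1 | h1
        · simp [h1]
        · rw [log_div h1 h0]
          field_simp
          ring
    rw [integral_congr_ae hpt, integral_sub _ (integrable_negMulLog_posterior P {x}),
      integral_sub (integrable_const _) ((integrable_posterior P {x}).mul_const _),
      integral_mul_const, integral_posterior, integral_const]
    · simp only [negMulLog, probReal_univ, smul_eq_mul]
      ring
    · exact (integrable_const _).sub ((integrable_posterior P {x}).mul_const _)
  simp_rw [hterm]
  rw [Finset.sum_sub_distrib, entropyDrop]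
  simp only [entropy]
  rw [integral_finsetSum _ fun x _ => integrable_negMulLog_posterior P {x}]

lemma mutualInfo_eq_ofReal_entropyDrop (P : ProbabilityMeasure (𝒜 × 𝒴)) :
    mutualInfo P = ENNReal.ofReal (entropyDrop P) :=
  (mutualInfo_eq_ofReal_and_entropyDrop_nonneg P).1

lemma entropyDrop_nonneg (P : ProbabilityMeasure (𝒜 × 𝒴)) : 0 ≤ entropyDrop P :=
  (mutualInfo_eq_ofReal_and_entropyDrop_nonneg P).2

end Posterior

/-! ### Sufficient statistics -/

section Sufficiency

open Real

variable {𝒜 ℬ 𝒴 : Type*} [Fintype 𝒜] [MeasurableSpace 𝒜] [DiscreteMeasurableSpace 𝒜]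
  [Fintype ℬ] [MeasurableSpace ℬ] [DiscreteMeasurableSpace ℬ] [MeasurableSpace 𝒴]

/-- The law of `X` given `f(X)` and `Y` does not depend on `Y`, expressed without conditional
expectations. -/
def FactorsThrough (P : ProbabilityMeasure (𝒜 × 𝒴)) (f : 𝒜 → ℬ) : Prop :=
  ∀ (x : 𝒜) (B : Set 𝒴), MeasurableSet B →
    (P : Measure (𝒜 × 𝒴)) ({x} ×ˢ B) * (P : Measure (𝒜 × 𝒴)).fst (f ⁻¹' {f x})
      = (P : Measure (𝒜 × 𝒴)).fst {x} * (P : Measure (𝒜 × 𝒴)) ((f ⁻¹' {f x}) ×ˢ B)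

lemma factorsThrough_of_injective (P : ProbabilityMeasure (𝒜 × 𝒴)) {f : 𝒜 → ℬ}
    (hf : Function.Injective f) : FactorsThrough P f := by
  intro x B _
  have : f ⁻¹' {f x} = {x} := by
    ext z
    simp [hf.eq_iff]
  rw [this, mul_comm]

/-- The chain `T(X) - X - Y` is automatic since `T(X)` is a function of `X`. The other chain equates
the laws of `Y` given `(T(X), X)` and given `T(X)`, which can be compared atom by atom on a finite
alphabet. Cross-multiplication keeps the criterion meaningful at atoms of mass zero. -/
lemma isSufficient_iff_factorsThrough [StandardBorelSpace 𝒴] (P : ProbabilityMeasure (𝒜 × 𝒴))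
    (T : 𝒜 → 𝒜) : IsSufficient P T ↔ FactorsThrough P T := by
  have hne : Nonempty 𝒜 := P.nonempty.map Prod.fst
  have hne' : Nonempty 𝒴 := P.nonempty.map Prod.snd
  have hT : Measurable T := Measurable.of_discrete
  have hTf : Measurable fun z : 𝒜 × 𝒴 => T z.1 := hT.comp measurable_fst
  have hk : Measurable fun z : 𝒜 × 𝒴 => (T z.1, z.1) := hTf.prodMk measurable_fst
  have h1 : CondIndepFun (MeasurableSpace.comap (Prod.fst : 𝒜 × 𝒴 → 𝒜) inferInstance)
      measurable_fst.comap_le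
      (fun p : 𝒜 × 𝒴 => T p.1) (fun p : 𝒜 × 𝒴 => p.2) (P : Measure (𝒜 × 𝒴)) :=
    condIndepFun_of_measurable_left (hT.comp (comap_measurable _)) measurable_snd
  have h2 := condIndepFun_iff_condDistrib_prod_ae_eq_prodMkRight (μ := (P : Measure (𝒜 × 𝒴)))
    (f := fun z : 𝒜 × 𝒴 => z.2) (g := fun z : 𝒜 × 𝒴 => z.1) measurable_snd measurable_fst hTf
  unfold IsSufficient
  rw [and_iff_right h1]
  refine h2.trans ?_
  rw [Filter.EventuallyEq, ae_iff_of_countable]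
  have hfst : ∀ s : Set 𝒜, (P : Measure (𝒜 × 𝒴)).fst s = (P : Measure (𝒜 × 𝒴)) (Prod.fst ⁻¹' s) :=
    fun s => Measure.fst_apply MeasurableSet.of_discrete
  have hTle : ∀ x : 𝒜, (P : Measure (𝒜 × 𝒴)).fst {x} ≤ (P : Measure (𝒜 × 𝒴)).fst (T ⁻¹' {T x}) :=
    fun x => measure_mono (by simp)
  have hmapk : ∀ x, (P : Measure (𝒜 × 𝒴)).map (fun z => (T z.1, z.1)) {(T x, x)}
      = (P : Measure (𝒜 × 𝒴)).fst {x} := by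
    intro x
    rw [Measure.map_apply hk (measurableSet_singleton _), hfst]
    congr 1
    ext ⟨z, y⟩
    simp only [Set.mem_preimage, Set.mem_singleton_iff, Prod.mk.injEq, and_iff_right_iff_imp]
    rintro rfl; rfl
  have hmapT : ∀ x, (P : Measure (𝒜 × 𝒴)).map (fun z => T z.1) {T x}
      = (P : Measure (𝒜 × 𝒴)).fst (T ⁻¹' {T x}) := by
    intro x
    rw [Measure.map_apply hTf (measurableSet_singleton _), hfst]
    rfl
  have hpair : ∀ x B, MeasurableSet B → (P : Measure (𝒜 × 𝒴)).map
      (fun z => ((T z.1, z.1), z.2)) ({(T x, x)} ×ˢ B) = (P : Measure (𝒜 × 𝒴)) ({x} ×ˢ B) := by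
    intro x B hB
    rw [Measure.map_apply (hk.prodMk measurable_snd) ((measurableSet_singleton _).prod hB)]
    congr 1
    ext ⟨z, y⟩
    simp only [Set.mem_preimage, Set.mem_prod, Set.mem_singleton_iff, Prod.mk.injEq]
    constructor
    · rintro ⟨⟨-, h⟩, h'⟩; exact ⟨h, h'⟩
    · rintro ⟨rfl, h'⟩; exact ⟨⟨rfl, rfl⟩, h'⟩
  have hpairT : ∀ x B, MeasurableSet B → (P : Measure (𝒜 × 𝒴)).map
      (fun z => (T z.1, z.2)) ({T x} ×ˢ B) = (P : Measure (𝒜 × 𝒴)) ((T ⁻¹' {T x}) ×ˢ B) := by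
    intro x B hB
    rw [Measure.map_apply (hTf.prodMk measurable_snd) ((measurableSet_singleton _).prod hB)]
    rfl
  have hcd : ∀ x, (P : Measure (𝒜 × 𝒴)).fst {x} ≠ 0 → ∀ B, MeasurableSet B →
      condDistrib (fun z : 𝒜 × 𝒴 => z.2) (fun z => (T z.1, z.1)) (P : Measure (𝒜 × 𝒴)) (T x, x) B
        = ((P : Measure (𝒜 × 𝒴)).fst {x})⁻¹ * (P : Measure (𝒜 × 𝒴)) ({x} ×ˢ B) := by
    intro x hx B hB
    rw [condDistrib_apply_of_ne_zero measurable_snd _ (by rwa [hmapk]), hmapk, hpair x B hB]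
  have hcdT : ∀ x, (P : Measure (𝒜 × 𝒴)).fst {x} ≠ 0 → ∀ B, MeasurableSet B →
      condDistrib (fun z : 𝒜 × 𝒴 => z.2) (fun z => T z.1) (P : Measure (𝒜 × 𝒴)) (T x) B
        = ((P : Measure (𝒜 × 𝒴)).fst (T ⁻¹' {T x}))⁻¹
          * (P : Measure (𝒜 × 𝒴)) ((T ⁻¹' {T x}) ×ˢ B) := by
    intro x hx B hB
    have : (P : Measure (𝒜 × 𝒴)).fst (T ⁻¹' {T x}) ≠ 0 :=
      fun h => hx (le_antisymm ((hTle x).trans_eq h) zero_le)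
    rw [condDistrib_apply_of_ne_zero measurable_snd _ (by rwa [hmapT]), hmapT, hpairT x B hB]
  have key : ∀ x, (P : Measure (𝒜 × 𝒴)).fst {x} ≠ 0 → ∀ B,
      (((P : Measure (𝒜 × 𝒴)).fst {x})⁻¹ * (P : Measure (𝒜 × 𝒴)) ({x} ×ˢ B)
        = ((P : Measure (𝒜 × 𝒴)).fst (T ⁻¹' {T x}))⁻¹
          * (P : Measure (𝒜 × 𝒴)) ((T ⁻¹' {T x}) ×ˢ B)
      ↔ (P : Measure (𝒜 × 𝒴)) ({x} ×ˢ B) * (P : Measure (𝒜 × 𝒴)).fst (T ⁻¹' {T x})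
        = (P : Measure (𝒜 × 𝒴)).fst {x} * (P : Measure (𝒜 × 𝒴)) ((T ⁻¹' {T x}) ×ˢ B)) := by
    intro x hx B
    have hx' : (P : Measure (𝒜 × 𝒴)).fst (T ⁻¹' {T x}) ≠ 0 :=
      fun h => hx (le_antisymm ((hTle x).trans_eq h) zero_le)
    rw [mul_comm, ← div_eq_mul_inv, mul_comm _ ((P : Measure (𝒜 × 𝒴)) ((T ⁻¹' {T x}) ×ˢ B)),
      ← div_eq_mul_inv, ENNReal.div_eq_div_iff hx' (measure_ne_top _ _) hx (measure_ne_top _ _),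
      mul_comm]
  constructor
  · intro h x B hB
    by_cases hx : (P : Measure (𝒜 × 𝒴)).fst {x} = 0
    · have h0 : (P : Measure (𝒜 × 𝒴)) ({x} ×ˢ B) = 0 := by
        rw [hfst] at hx
        exact measure_mono_null (fun z hz => hz.1) hx
      rw [h0, hx, zero_mul, zero_mul]
    · rw [← key x hx B, ← hcd x hx B hB, ← hcdT x hx B hB, h (T x, x) (by rwa [hmapk])]
      rfl
  · rintro h ⟨s, x⟩ hsx
    obtain rfl : s = T x := by
      by_contra hne
      refine hsx ?_
      rw [Measure.map_apply hk (measurableSet_singleton _)]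
      convert measure_empty (μ := (P : Measure (𝒜 × 𝒴)))
      ext ⟨z, y⟩
      simp only [Set.mem_preimage, Set.mem_singleton_iff, Prod.mk.injEq, Set.mem_empty_iff_false,
        iff_false, not_and]
      rintro h1 rfl
      exact hne h1.symm
    rw [hmapk] at hsx
    ext B hB
    rw [hcd x hsx B hB, (key x hsx B).2 (h x B hB), ← hcdT x hsx B hB]
    rfl

lemma toMeasure_mapPrivate (P : ProbabilityMeasure (𝒜 × 𝒴)) (f : 𝒜 → ℬ) :
    (mapPrivate f P : Measure (ℬ × 𝒴)) = (P : Measure (𝒜 × 𝒴)).map (Prod.map f id) :=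
  rfl

lemma measurable_prodMap_id (f : 𝒜 → ℬ) :
    Measurable (Prod.map f id : 𝒜 × 𝒴 → ℬ × 𝒴) :=
  (Measurable.of_discrete (f := f)).prodMap measurable_id

lemma snd_mapPrivate (P : ProbabilityMeasure (𝒜 × 𝒴)) (f : 𝒜 → ℬ) :
    (mapPrivate f P : Measure (ℬ × 𝒴)).snd = (P : Measure (𝒜 × 𝒴)).snd := by
  rw [toMeasure_mapPrivate, Measure.snd, Measure.map_map measurable_snd (measurable_prodMap_id f)]
  rfl

lemma fst_mapPrivate (P : ProbabilityMeasure (𝒜 × 𝒴)) (f : 𝒜 → ℬ) :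
    (mapPrivate f P : Measure (ℬ × 𝒴)).fst = (P : Measure (𝒜 × 𝒴)).fst.map f := by
  rw [toMeasure_mapPrivate, Measure.fst, Measure.map_map measurable_fst (measurable_prodMap_id f),
    Measure.fst, Measure.map_map Measurable.of_discrete measurable_fst]
  rfl

lemma posterior_mapPrivate (P : ProbabilityMeasure (𝒜 × 𝒴)) (f : 𝒜 → ℬ) :
    ∀ᵐ y ∂(P : Measure (𝒜 × 𝒴)).snd,
      (posterior (mapPrivate f P) y : Measure ℬ) = (posterior P y : Measure 𝒜).map f := by
  obtain ⟨κ, _, hP, hκ⟩ := exists_kernel_posterior P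
  have hf : Measurable f := Measurable.of_discrete
  have := Kernel.IsMarkovKernel.map κ hf
  have h := posterior_ae_eq (P := mapPrivate f P) (κ := κ.map f) (by
    rw [snd_mapPrivate, Measure.compProd_map hf, hP, toMeasure_mapPrivate,
      Measure.map_map (measurable_id.prodMap hf) measurable_swap,
      Measure.map_map measurable_swap (measurable_prodMap_id f)]
    rfl)
  rw [snd_mapPrivate] at h
  filter_upwards [h] with y hy
  rw [hy, Kernel.map_apply _ hf, hκ]

lemma sum_fiber_mul (μ : Measure 𝒜) [IsFiniteMeasure μ] (f : 𝒜 → ℬ) (g : ℬ → ℝ) :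
    ∑ s, μ.real (f ⁻¹' {s}) * g s = ∑ x, μ.real {x} * g (f x) := by
  classical
  rw [← Finset.sum_fiberwise (s := Finset.univ) (g := f)]
  refine Finset.sum_congr rfl fun s _ => ?_
  have : f ⁻¹' {s} = ((Finset.univ.filter fun x => f x = s : Finset 𝒜) : Set 𝒜) := by
    ext; simp
  rw [this, ← sum_measureReal_singleton, Finset.sum_mul]
  refine Finset.sum_congr rfl fun x hx => ?_
  rw [(Finset.mem_filter.1 hx).2]

/-- This is one summand of the chain rule: `ρ = (p / q) * σ`, and the logarithm splits the product.
Here `p` and `ρ` stand for the masses of a letter under two laws, `q` and `σ` for the masses of its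
fibre. -/
lemma negMulLog_eq_of_mul_eq {ρ σ p q : ℝ} (hp : 0 ≤ p) (hpq : p ≤ q) (hρσ : 0 ≤ ρ) (hle : ρ ≤ σ)
    (h : ρ * q = p * σ) (hp0 : p = 0 → ρ = 0) :
    negMulLog ρ = ρ * (-log (p / q)) + ρ * (-log σ) := by
  rcases hρσ.eq_or_lt with rfl | hρ
  · simp
  have hp' : 0 < p := lt_of_le_of_ne hp fun h0 => hρ.ne' (hp0 h0.symm)
  have hq : 0 < q := hp'.trans_le hpq
  have hσ : 0 < σ := hρ.trans_le hle
  have e : ρ = p / q * σ := by field_simp; linarith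
  have : log ρ = log (p / q) + log σ := by
    conv_lhs => rw [e]
    rw [log_mul (by positivity) hσ.ne']
  rw [negMulLog, this]
  ring

/-- The entropy chain rule for a function of a finite random variable, when the conditional law
given the value of the function is prescribed by the law `p`. -/
lemma entropy_eq_of_mul_eq {p ρ : Measure 𝒜} [IsFiniteMeasure p] [IsFiniteMeasure ρ] {f : 𝒜 → ℬ}
    (h : ∀ x, ρ.real {x} * p.real (f ⁻¹' {f x}) = p.real {x} * ρ.real (f ⁻¹' {f x}))
    (h0 : ∀ x, p.real {x} = 0 → ρ.real {x} = 0) :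
    entropy ρ = ∑ x, ρ.real {x} * (-log (p.real {x} / p.real (f ⁻¹' {f x})))
      + entropy (ρ.map f) := by
  have hle : ∀ (μ : Measure 𝒜) [IsFiniteMeasure μ] x, μ.real {x} ≤ μ.real (f ⁻¹' {f x}) :=
    fun μ _ x => measureReal_mono (by simp)
  have hmap : entropy (ρ.map f) = ∑ x, ρ.real {x} * (-log (ρ.real (f ⁻¹' {f x}))) := by
    rw [← sum_fiber_mul ρ f fun s => -log (ρ.real (f ⁻¹' {s})), entropy]
    refine Finset.sum_congr rfl fun s _ => ?_
    rw [map_measureReal_apply Measurable.of_discrete MeasurableSet.of_discrete, negMulLog]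
    ring
  rw [hmap, ← Finset.sum_add_distrib]
  exact Finset.sum_congr rfl fun x _ => negMulLog_eq_of_mul_eq measureReal_nonneg (hle p x)
    measureReal_nonneg (hle ρ x) (h x) (h0 x)

/-- Reducing the private variable to a sufficient statistic does not change the information. -/
theorem entropyDrop_mapPrivate {P : ProbabilityMeasure (𝒜 × 𝒴)} {f : 𝒜 → ℬ}
    (h : FactorsThrough P f) : entropyDrop (mapPrivate f P) = entropyDrop P := by
  set ν := (P : Measure (𝒜 × 𝒴)).snd with hν
  set p := (P : Measure (𝒜 × 𝒴)).fst with hp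
  -- Sufficiency says that the law of `X` given `f(X)` is the same under the prior and under almost
  -- every posterior. The chain rule therefore writes both entropies as the same linear function of
  -- the law plus the entropy of `f(X)`, and the linear part averages out.
  have hae : ∀ᵐ y ∂ν, entropy (posterior P y : Measure 𝒜)
      = ∑ x, (posterior P y : Measure 𝒜).real {x} * (-log (p.real {x} / p.real (f ⁻¹' {f x})))
        + entropy ((posterior P y : Measure 𝒜).map f) := by
    have hx : ∀ᵐ y ∂ν, ∀ x, (posterior P y : Measure 𝒜).real {x} * p.real (f ⁻¹' {f x})
        = p.real {x} * (posterior P y : Measure 𝒜).real (f ⁻¹' {f x}) := by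
      refine ae_all_iff.2 fun x => ?_
      refine Integrable.ae_eq_of_forall_setIntegral_eq _ _
        ((integrable_posterior P _).mul_const _) ((integrable_posterior P _).const_mul _)
        fun B hB _ => ?_
      rw [integral_mul_const, integral_const_mul, setIntegral_posterior P _ hB,
        setIntegral_posterior P _ hB]
      have := congrArg ENNReal.toReal (h x B hB)
      rwa [ENNReal.toReal_mul, ENNReal.toReal_mul] at this
    have hx0 : ∀ᵐ y ∂ν, ∀ x, p.real {x} = 0 → (posterior P y : Measure 𝒜).real {x} = 0 := by
      refine ae_all_iff.2 fun x => ?_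
      by_cases h0 : p.real {x} = 0
      · filter_upwards [ae_posterior_eq_zero P h0] with y hy _ using hy
      · exact ae_of_all _ fun y h1 => absurd h1 h0
    filter_upwards [hx, hx0] with y h1 h2 using entropy_eq_of_mul_eq h1 h2
  have hpost : ∀ᵐ y ∂ν, entropy (posterior (mapPrivate f P) y : Measure ℬ)
      = entropy ((posterior P y : Measure 𝒜).map f) := by
    filter_upwards [posterior_mapPrivate P f] with y hy
    rw [hy]
  have hlin : ∀ x ∈ Finset.univ, Integrable (fun y => (posterior P y : Measure 𝒜).real {x}
      * (-log (p.real {x} / p.real (f ⁻¹' {f x})))) ν :=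
    fun x _ => (integrable_posterior P {x}).mul_const _
  have hmap : Integrable (fun y => entropy ((posterior P y : Measure 𝒜).map f)) ν := by
    refine Integrable.congr ?_ hpost
    have := integrable_entropy_posterior (mapPrivate f P)
    rwa [snd_mapPrivate] at this
  have hprior := entropy_eq_of_mul_eq (p := p) (ρ := p) (f := f) (fun x => rfl) fun x hx => hx
  unfold entropyDrop
  rw [snd_mapPrivate, fst_mapPrivate, integral_congr_ae hpost, integral_congr_ae hae,
    integral_add (integrable_finsetSum _ hlin) hmap, integral_finsetSum _ hlin, ← hp, hprior]
  have hpost_int : ∀ x, ∫ y, (posterior P y : Measure 𝒜).real {x} ∂ν = p.real {x} :=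
    fun x => integral_posterior P {x}
  simp_rw [integral_mul_const, hpost_int]
  ring

end Sufficiency

/-! ### Mixtures and concavity of the Bayes envelope -/

section Mixture

variable {Ω : Type*} [MeasurableSpace Ω]

/-- The mixture `w p + (1 - w) q` of two laws. -/
def mixture (w : unitInterval) (p q : ProbabilityMeasure Ω) : ProbabilityMeasure Ω :=
  ⟨ENNReal.ofReal w • (p : Measure Ω) + ENNReal.ofReal (1 - w) • (q : Measure Ω), ⟨by
    simp only [Measure.coe_add, Measure.coe_smul, Pi.add_apply, Pi.smul_apply, measure_univ,
      smul_eq_mul, mul_one]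
    rw [← ENNReal.ofReal_add w.2.1 (sub_nonneg.2 w.2.2)]
    simp⟩⟩

lemma toMeasure_mixture (w : unitInterval) (p q : ProbabilityMeasure Ω) :
    (mixture w p q : Measure Ω)
      = ENNReal.ofReal w • (p : Measure Ω) + ENNReal.ofReal (1 - w) • (q : Measure Ω) := rfl

lemma mixture_real (w : unitInterval) (p q : ProbabilityMeasure Ω) (s : Set Ω) :
    (mixture w p q : Measure Ω).real s
      = w * (p : Measure Ω).real s + (1 - w) * (q : Measure Ω).real s := by
  have hfin : ∀ (r : ℝ) (p : ProbabilityMeasure Ω), (ENNReal.ofReal r • (p : Measure Ω)) s ≠ ∞ :=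
    fun r p => ENNReal.mul_ne_top ENNReal.ofReal_ne_top (measure_ne_top _ _)
  rw [toMeasure_mixture, measureReal_add_apply (hfin _ _) (hfin _ _), measureReal_ennreal_smul_apply,
    measureReal_ennreal_smul_apply, ENNReal.toReal_ofReal w.2.1,
    ENNReal.toReal_ofReal (sub_nonneg.2 w.2.2)]

lemma ext_of_real_singleton [Countable Ω] {p q : ProbabilityMeasure Ω}
    (h : ∀ x, (p : Measure Ω).real {x} = (q : Measure Ω).real {x}) : p = q := by
  refine Subtype.ext (show (p : Measure Ω) = q from Measure.ext_iff_singleton.2 fun x => ?_)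
  exact (measureReal_eq_measureReal_iff (measure_ne_top _ _) (measure_ne_top _ _)).1 (h x)

/-- The point mass as a probability measure. -/
def pointMass (x : Ω) : ProbabilityMeasure Ω := ⟨Measure.dirac x, inferInstance⟩

lemma toMeasure_pointMass (x : Ω) : (pointMass x : Measure Ω) = Measure.dirac x := rfl

lemma pointMass_real_self [MeasurableSingletonClass Ω] (x : Ω) :
    (pointMass x : Measure Ω).real {x} = 1 := by
  simp [toMeasure_pointMass, measureReal_def]

lemma pointMass_real_of_ne [MeasurableSingletonClass Ω] {x y : Ω} (h : y ≠ x) :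
    (pointMass x : Measure Ω).real {y} = 0 := by
  simp [toMeasure_pointMass, measureReal_def, h.symm]

variable [Fintype Ω]

lemma expectedLoss_mixture {ℓ : Ω → ProbabilityMeasure Ω → EReal} (w : unitInterval)
    (p q Q : ProbabilityMeasure Ω) :
    expectedLoss ℓ (mixture w p q) Q
      = ((w : ℝ) : EReal) * expectedLoss ℓ p Q + ((1 - w : ℝ) : EReal) * expectedLoss ℓ q Q := by
  have hmul : ∀ (r : ℝ), 0 ≤ r → ∀ g : Ω → EReal, (r : EReal) * ∑ x, g x = ∑ x, (r : EReal) * g x := by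
    intro r hr g
    exact map_sum (⟨⟨fun z => (r : EReal) * z, mul_zero _⟩,
      fun y z => EReal.left_distrib_of_nonneg_of_ne_top (by exact_mod_cast hr)
        (EReal.coe_ne_top r) y z⟩ : EReal →+ EReal) g Finset.univ
  have hw := w.2.1
  have hw' : (0 : ℝ) ≤ 1 - w := sub_nonneg.2 w.2.2
  unfold expectedLoss
  rw [hmul _ hw, hmul _ hw', ← Finset.sum_add_distrib]
  refine Finset.sum_congr rfl fun x _ => ?_
  rw [mixture_real, EReal.coe_add, EReal.right_distrib_of_nonneg
    (by exact_mod_cast mul_nonneg hw measureReal_nonneg)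
    (by exact_mod_cast mul_nonneg hw' measureReal_nonneg), EReal.coe_mul, EReal.coe_mul, mul_assoc,
    mul_assoc]

/-- An infimum of functions linear in the law is concave. This is the only regularity of the
envelope available to exclude pathological solutions of the functional equation. -/
lemma bayesEnvelope_mixture_ge {ℓ : Ω → ProbabilityMeasure Ω → EReal} (hℓ : IsLossFunction ℓ)
    (w : unitInterval) (p q : ProbabilityMeasure Ω) :
    w * (bayesEnvelope ℓ p).toReal + (1 - w) * (bayesEnvelope ℓ q).toReal
      ≤ (bayesEnvelope ℓ (mixture w p q)).toReal := by
  have hc : ∀ p, (((bayesEnvelope ℓ p).toReal : ℝ) : EReal) = bayesEnvelope ℓ p :=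
    fun p => EReal.coe_toReal (hℓ.2 p).2 (hℓ.2 p).1
  rw [← EReal.coe_le_coe_iff, hc, EReal.coe_add, EReal.coe_mul, EReal.coe_mul, hc, hc]
  refine le_iInf fun Q => ?_
  rw [expectedLoss_mixture]
  have hw := w.2.1
  have hw' : (0 : ℝ) ≤ 1 - w := sub_nonneg.2 w.2.2
  exact add_le_add
    (mul_le_mul_of_nonneg_left (iInf_le _ Q) (by exact_mod_cast hw))
    (mul_le_mul_of_nonneg_left (iInf_le _ Q) (by exact_mod_cast hw'))

end Mixture

/-! ### The logarithmic loss -/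

section LogLoss

open Real

variable {𝒜 𝒴 : Type*} [Fintype 𝒜] [MeasurableSpace 𝒜] [DiscreteMeasurableSpace 𝒜]
  [MeasurableSpace 𝒴]

open Classical in
/-- The logarithmic loss `-c log Q(x)`. -/
def logLoss (c : ℝ) (x : 𝒜) (Q : ProbabilityMeasure 𝒜) : EReal :=
  if (Q : Measure 𝒜).real {x} = 0 then ⊤ else ((-c * log ((Q : Measure 𝒜).real {x}) : ℝ) : EReal)

lemma coe_finsetSum (s : Finset 𝒜) (g : 𝒜 → ℝ) :
    ((∑ x ∈ s, g x : ℝ) : EReal) = ∑ x ∈ s, (g x : EReal) :=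
  map_sum (⟨⟨Real.toEReal, EReal.coe_zero⟩, EReal.coe_add⟩ : ℝ →+ EReal) g s

/-- Gibbs' inequality: the Bayes envelope of the logarithmic loss is the entropy. -/
lemma bayesEnvelope_logLoss {c : ℝ} (hc : 0 ≤ c) (p : ProbabilityMeasure 𝒜) :
    bayesEnvelope (logLoss c) p = ((c * entropy (p : Measure 𝒜) : ℝ) : EReal) := by
  refine le_antisymm ((iInf_le _ p).trans_eq ?_) (le_iInf fun Q => ?_)
  · rw [expectedLoss, entropy, Finset.mul_sum, coe_finsetSum]
    refine Finset.sum_congr rfl fun x _ => ?_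
    rw [logLoss]
    split_ifs with h
    · simp [h]
    · rw [← EReal.coe_mul, negMulLog]
      congr 1
      ring
  -- Adding `p(x) - Q(x)`, which sums to zero, reduces Gibbs' inequality to the termwise bound `log
  -- r ≤ r - 1` at `r = Q(x) / p(x)`.
  · have e : c * entropy (p : Measure 𝒜) = ∑ x, c * (negMulLog ((p : Measure 𝒜).real {x})
        + (p : Measure 𝒜).real {x} - (Q : Measure 𝒜).real {x}) := by
      rw [← Finset.mul_sum, Finset.sum_sub_distrib, Finset.sum_add_distrib, sum_real_singleton,
        sum_real_singleton, entropy]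
      ring
    rw [e, coe_finsetSum, expectedLoss]
    refine Finset.sum_le_sum fun x _ => ?_
    have hp : 0 ≤ (p : Measure 𝒜).real {x} := measureReal_nonneg
    have hQ : 0 ≤ (Q : Measure 𝒜).real {x} := measureReal_nonneg
    rcases hp.eq_or_lt with h0 | h0
    · rw [← h0]
      simp only [negMulLog_zero, EReal.coe_zero, zero_mul]
      rw [← EReal.coe_zero, EReal.coe_le_coe_iff]
      nlinarith
    · rw [logLoss]
      split_ifs with h
      · rw [EReal.coe_mul_top_of_pos h0]
        exact le_top
      · rw [← EReal.coe_mul, EReal.coe_le_coe_iff]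
        have hQ' : 0 < (Q : Measure 𝒜).real {x} := lt_of_le_of_ne hQ (Ne.symm h)
        have := log_le_sub_one_of_pos (div_pos hQ' h0)
        rw [log_div hQ'.ne' h0.ne', le_sub_iff_add_le, le_div_iff₀ h0] at this
        rw [negMulLog]
        nlinarith [mul_le_mul_of_nonneg_left this hc]

lemma isLossFunction_logLoss {c : ℝ} (hc : 0 ≤ c) :
    IsLossFunction (logLoss c : 𝒜 → ProbabilityMeasure 𝒜 → EReal) := by
  refine ⟨fun x Q => ?_, fun p => ?_⟩
  · rw [logLoss]
    split_ifs
    · exact top_ne_bot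
    · exact EReal.coe_ne_bot _
  · rw [bayesEnvelope_logLoss hc]
    exact ⟨EReal.coe_ne_bot _, EReal.coe_ne_top _⟩

lemma envelopeDrop_logLoss [StandardBorelSpace 𝒴] {c : ℝ} (hc : 0 ≤ c)
    (P : ProbabilityMeasure (𝒜 × 𝒴)) :
    envelopeDrop (logLoss c) P = c * entropyDrop P := by
  refine envelopeDrop_eq_mul_entropyDrop (a := fun _ => 0) (fun p => ?_) P
  rw [bayesEnvelope_logLoss hc, EReal.toReal_coe]
  simp

lemma isPrivacyLeakage_logLoss [StandardBorelSpace 𝒴] {c : ℝ} (hc : 0 ≤ c) :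
    IsPrivacyLeakage (logLoss c : 𝒜 → ProbabilityMeasure 𝒜 → EReal)
      (fun P : ProbabilityMeasure (𝒜 × 𝒴) => c * entropyDrop P) where
  isLossFunction := isLossFunction_logLoss hc
  eq_envelopeDrop P := (envelopeDrop_logLoss hc P).symm
  dataProcessing P T hT := by
    simp only [entropyDrop_mapPrivate ((isSufficient_iff_factorsThrough P T).1 hT)]

end LogLoss

/-! ### Concave functions of laws whose gaps are invariant under merging -/

section Merge

open Real

variable {𝒜 : Type*} [Fintype 𝒜] [MeasurableSpace 𝒜] [DiscreteMeasurableSpace 𝒜]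

/-- The concavity gap of `V` at a mixture. -/
def concavityGap (V : ProbabilityMeasure 𝒜 → ℝ) (w : unitInterval) (p q : ProbabilityMeasure 𝒜) :
    ℝ :=
  V (mixture w p q) - (w * V p + (1 - w) * V q)

/-- The grouping property of entropy. It is the same recursion that `V` obeys when a letter is
peeled off. -/
lemma entropy_mixture_pointMass (w : unitInterval) {a : 𝒜} {p : ProbabilityMeasure 𝒜}
    (hp : (p : Measure 𝒜).real {a} = 0) :
    entropy (mixture w (pointMass a) p : Measure 𝒜)
      = binEntropy w + (1 - w) * entropy (p : Measure 𝒜) := by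
  classical
  have hterm : ∀ x, negMulLog ((mixture w (pointMass a) p : Measure 𝒜).real {x})
      = (if x = a then negMulLog w else 0) + ((p : Measure 𝒜).real {x} * negMulLog (1 - w)
        + (1 - w) * negMulLog ((p : Measure 𝒜).real {x})) := by
    intro x
    rw [mixture_real]
    split_ifs with h
    · subst h
      simp [-ProbabilityMeasure.measureReal_eq_coe_coeFn, hp, pointMass_real_self]
    · rw [pointMass_real_of_ne h, mul_zero, zero_add, zero_add, negMulLog_mul]
  rw [entropy, Finset.sum_congr rfl fun x _ => hterm x, Finset.sum_add_distrib,
    Finset.sum_add_distrib, ← Finset.sum_mul, ← Finset.mul_sum, sum_real_singleton,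
    Finset.sum_ite_eq' Finset.univ a, if_pos (Finset.mem_univ a),
    binEntropy_eq_negMulLog_add_negMulLog_one_sub, entropy]
  ring

/-- The law `q` is `p` conditioned on the complement of `a`. No mass appears outside the support of
`p`, which lets an induction on the size of the support proceed. -/
lemma exists_eq_mixture_pointMass {p : ProbabilityMeasure 𝒜} {a : 𝒜}
    (h : (p : Measure 𝒜).real {a} ≠ 1) :
    ∃ (w : unitInterval) (q : ProbabilityMeasure 𝒜), p = mixture w (pointMass a) q ∧
      (w : ℝ) = (p : Measure 𝒜).real {a} ∧ (q : Measure 𝒜).real {a} = 0 ∧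
      ∀ x, (p : Measure 𝒜).real {x} = 0 → (q : Measure 𝒜).real {x} = 0 := by
  have hcompl : (p : Measure 𝒜).real {a}ᶜ = 1 - (p : Measure 𝒜).real {a} :=
    probReal_compl_eq_one_sub (measurableSet_singleton a)
  have hne : (p : Measure 𝒜).real {a}ᶜ ≠ 0 := by
    rw [hcompl, sub_ne_zero]
    exact h.symm
  have hne' : (p : Measure 𝒜) {a}ᶜ ≠ 0 := fun h0 => hne (by rw [measureReal_def, h0]; rfl)
  have hq : IsProbabilityMeasure ((p : Measure 𝒜)[|{a}ᶜ]) := cond_isProbabilityMeasure hne'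
  obtain ⟨q, hqcoe⟩ : ∃ q : ProbabilityMeasure 𝒜, (q : Measure 𝒜) = (p : Measure 𝒜)[|{a}ᶜ] :=
    ⟨⟨_, hq⟩, rfl⟩
  have hreal : ∀ x, (q : Measure 𝒜).real {x}
      = ((p : Measure 𝒜).real {a}ᶜ)⁻¹ * (p : Measure 𝒜).real ({a}ᶜ ∩ {x}) :=
    fun x => by
      rw [hqcoe, measureReal_def, cond_apply (measurableSet_singleton a).compl, ENNReal.toReal_mul,
        ENNReal.toReal_inv, measureReal_def, measureReal_def]
  have hw : (p : Measure 𝒜).real {a} ∈ unitInterval := ⟨measureReal_nonneg, measureReal_le_one⟩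
  refine ⟨⟨(p : Measure 𝒜).real {a}, hw⟩,
    q, ext_of_real_singleton fun x => ?_, rfl, ?_, fun x hx => ?_⟩
  · rw [mixture_real, hreal]
    by_cases hxa : x = a
    · subst hxa
      simp [-ProbabilityMeasure.measureReal_eq_coe_coeFn, pointMass_real_self]
    · have : ({a}ᶜ ∩ {x} : Set 𝒜) = {x} := by
        ext z; simp only [Set.mem_inter_iff, Set.mem_compl_iff, Set.mem_singleton_iff]
        constructor
        · exact fun h => h.2
        · rintro rfl; exact ⟨hxa, rfl⟩
      rw [this, pointMass_real_of_ne hxa, ← hcompl]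
      field_simp
      ring
  · rw [hreal]
    simp [-ProbabilityMeasure.measureReal_eq_coe_coeFn]
  · rw [hreal]
    have : (p : Measure 𝒜).real ({a}ᶜ ∩ {x}) = 0 :=
      le_antisymm ((measureReal_mono Set.inter_subset_right).trans_eq hx) measureReal_nonneg
    rw [this, mul_zero]

lemma mixture_symm (w : unitInterval) (p q : ProbabilityMeasure 𝒜) :
    mixture (unitInterval.symm w) p q = mixture w q p := by
  refine ext_of_real_singleton fun x => ?_
  simp only [mixture_real, unitInterval.coe_symm_eq]
  ring

variable {V : ProbabilityMeasure 𝒜 → ℝ}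

/-- If the gap at a mixture of a point mass and a law off that point does not depend on the law,
then `V` is, up to an affine function, a multiple of the entropy. -/
theorem eq_affine_add_mul_entropy (hcard : 3 ≤ Fintype.card 𝒜)
    (hconc : ∀ w p q, w * V p + (1 - w) * V q ≤ V (mixture w p q))
    (hmerge : ∀ (w : unitInterval) (a b : 𝒜) (p : ProbabilityMeasure 𝒜), a ≠ b →
      (p : Measure 𝒜).real {a} = 0 →
      concavityGap V w (pointMass a) p = concavityGap V w (pointMass a) (pointMass b)) :
    ∃ c : ℝ, 0 ≤ c ∧ ∀ p, V p
      = ∑ x, (p : Measure 𝒜).real {x} * V (pointMass x) + c * entropy (p : Measure 𝒜) := by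
  classical
  obtain ⟨a, b, d, hab, had, hbd⟩ := Fintype.two_lt_card_iff.1 hcard
  set H : unitInterval → ℝ := fun w => concavityGap V w (pointMass a) (pointMass b) with hH
  have gap_right : ∀ w {x y z : 𝒜}, x ≠ y → x ≠ z →
      concavityGap V w (pointMass x) (pointMass y)
        = concavityGap V w (pointMass x) (pointMass z) :=
    fun w x y z hxy hxz => hmerge w x z _ hxz (pointMass_real_of_ne hxy)
  have gap_swap : ∀ w (x y : 𝒜), concavityGap V (unitInterval.symm w) (pointMass x) (pointMass y)
      = concavityGap V w (pointMass y) (pointMass x) := by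
    intro w x y
    simp only [concavityGap, mixture_symm, unitInterval.coe_symm_eq]
    ring
  -- The third letter makes the symmetry possible: the ordered pair moves from `(b, a)` through `(b,
  -- d)`, `(d, b)`, `(d, a)` and `(a, d)` to `(a, b)`, alternately changing the second letter and
  -- swapping.
  have Hsymm : ∀ w, H (unitInterval.symm w) = H w := by
    intro w
    simp only [hH]
    rw [gap_swap, gap_right w hab.symm hbd, ← gap_swap w d b, gap_right _ hbd.symm had.symm,
      gap_swap, gap_right w had hab]
  have gap_left : ∀ w {x : 𝒜}, x ≠ a → concavityGap V w (pointMass x) (pointMass a) = H w := by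
    intro w x hx
    rw [← gap_swap, gap_right _ hx.symm hab]
    exact Hsymm w
  have gap_eq : ∀ w {x y : 𝒜}, x ≠ y → concavityGap V w (pointMass x) (pointMass y) = H w := by
    intro w x y hxy
    by_cases hx : x = a
    · subst hx
      exact gap_right w hxy hab
    · rw [gap_right w hxy hx, gap_left w hx]
  have hchain : ∀ (w : unitInterval) (x : 𝒜) (p : ProbabilityMeasure 𝒜),
      (p : Measure 𝒜).real {x} = 0 →
      V (mixture w (pointMass x) p) = H w + (w * V (pointMass x) + (1 - w) * V p) := by
    intro w x p hp
    have : ∃ y, x ≠ y := by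
      by_cases hx : x = a
      · exact ⟨b, hx ▸ hab⟩
      · exact ⟨a, hx⟩
    obtain ⟨y, hy⟩ := this
    rw [← gap_eq w hy, ← hmerge w x y p hy hp, concavityGap]
    ring
  have hpair : ∀ (w : unitInterval) {x y : 𝒜}, x ≠ y →
      V (mixture w (pointMass x) (pointMass y))
        = H w + (w * V (pointMass x) + (1 - w) * V (pointMass y)) :=
    fun w x y hxy => hchain w x _ (pointMass_real_of_ne hxy)
  set h : ℝ → ℝ := fun x => H (Set.projIcc 0 1 zero_le_one x) with hh
  have hmem : ∀ {x : ℝ} (hx : x ∈ Set.Icc (0 : ℝ) 1), h x = H ⟨x, hx⟩ := fun hx => by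
    simp only [hh, Set.projIcc_of_mem _ hx]
  have hcoe : ∀ w : unitInterval, h w = H w := fun w => hmem w.2
  obtain ⟨c, hc0, hc⟩ := eq_mul_binEntropy_of_fundamental_equation (h := h) (by
      refine ⟨convex_Icc 0 1, fun x hx y hy s t hs ht hst => ?_⟩
      have hz := (convex_Icc (0 : ℝ) 1) hx hy hs ht hst
      rw [hmem hx, hmem hy, hmem hz]
      have ht' : t = 1 - s := by linarith
      -- On the segment between two point masses `V` is `h` plus an affine function, so `h` inherits
      -- the concavity of `V`.
      have hmix : mixture ⟨s • x + t • y, hz⟩ (pointMass a) (pointMass b)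
          = mixture ⟨s, hs, by linarith⟩ (mixture ⟨x, hx⟩ (pointMass a) (pointMass b))
            (mixture ⟨y, hy⟩ (pointMass a) (pointMass b)) := by
        refine ext_of_real_singleton fun z => ?_
        simp only [mixture_real, smul_eq_mul, ht']
        ring
      have h1 := hconc ⟨s, hs, by linarith⟩ (mixture ⟨x, hx⟩ (pointMass a) (pointMass b))
        (mixture ⟨y, hy⟩ (pointMass a) (pointMass b))
      rw [← hmix, hpair _ hab, hpair _ hab, hpair _ hab] at h1
      simp only [smul_eq_mul, ht'] at h1 ⊢
      linarith) (by
      rw [hmem ⟨le_rfl, zero_le_one⟩]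
      have : mixture ⟨0, le_rfl, zero_le_one⟩ (pointMass a) (pointMass b) = pointMass b :=
        ext_of_real_singleton fun z => by simp [-ProbabilityMeasure.measureReal_eq_coe_coeFn, mixture_real]
      simp [-ProbabilityMeasure.measureReal_eq_coe_coeFn, hH, concavityGap, this]) (by
      rw [hmem ⟨zero_le_one, le_rfl⟩]
      have : mixture ⟨1, zero_le_one, le_rfl⟩ (pointMass a) (pointMass b) = pointMass a :=
        ext_of_real_singleton fun z => by simp [-ProbabilityMeasure.measureReal_eq_coe_coeFn, mixture_real]
      simp [-ProbabilityMeasure.measureReal_eq_coe_coeFn, hH, concavityGap, this]) (by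
      intro x hx
      rw [hmem hx, ← Hsymm ⟨x, hx⟩]
      exact hcoe (unitInterval.symm ⟨x, hx⟩)) (by
      intro x y hx hy hxy
      have hx1 : 0 < 1 - x := by linarith
      have hy1 : 0 < 1 - y := by linarith
      have mx : x ∈ Set.Icc (0 : ℝ) 1 := ⟨hx.le, by linarith⟩
      have my : y ∈ Set.Icc (0 : ℝ) 1 := ⟨hy.le, by linarith⟩
      have mx' : y / (1 - x) ∈ Set.Icc (0 : ℝ) 1 :=
        ⟨by positivity, by rw [div_le_one hx1]; linarith⟩
      have my' : x / (1 - y) ∈ Set.Icc (0 : ℝ) 1 :=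
        ⟨by positivity, by rw [div_le_one hy1]; linarith⟩
      -- The law with masses `x`, `y`, `1 - x - y` at `a`, `b`, `d` is peeled in two ways, `a` first
      -- or `b` first. Equating the resulting values of `V` gives the fundamental equation.
      have hmix : mixture ⟨x, mx⟩ (pointMass a) (mixture ⟨_, mx'⟩ (pointMass b) (pointMass d))
          = mixture ⟨y, my⟩ (pointMass b) (mixture ⟨_, my'⟩ (pointMass a) (pointMass d)) := by
        refine ext_of_real_singleton fun z => ?_
        simp only [mixture_real]
        field_simp
        ring
      have h1 := congrArg V hmix
      have h0a : (mixture ⟨_, mx'⟩ (pointMass b) (pointMass d) : Measure 𝒜).real {a} = 0 := by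
        rw [mixture_real, pointMass_real_of_ne hab, pointMass_real_of_ne had]
        ring
      have h0b : (mixture ⟨_, my'⟩ (pointMass a) (pointMass d) : Measure 𝒜).real {b} = 0 := by
        rw [mixture_real, pointMass_real_of_ne hab.symm, pointMass_real_of_ne hbd]
        ring
      rw [hchain _ _ _ h0a, hchain _ _ _ h0b, hpair _ hbd, hpair _ had] at h1
      rw [hmem mx, hmem my, hmem mx', hmem my']
      simp only at h1
      have e1 : (1 - x) * (y / (1 - x)) = y := by field_simp
      have e2 : (1 - y) * (x / (1 - y)) = x := by field_simp
      linear_combination h1 + (V (pointMass d) - V (pointMass b)) * e1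
        + (V (pointMass a) - V (pointMass d)) * e2)
  refine ⟨c, hc0, ?_⟩
  have hHc : ∀ w : unitInterval, H w = c * binEntropy w := fun w => (hcoe w).symm.trans (hc w w.2)
  suffices key : ∀ (n : ℕ) (p : ProbabilityMeasure 𝒜),
      (Finset.univ.filter fun x => (p : Measure 𝒜).real {x} ≠ 0).card ≤ n →
      V p = ∑ x, (p : Measure 𝒜).real {x} * V (pointMass x) + c * entropy (p : Measure 𝒜) from
    fun p => key _ p le_rfl
  intro n
  induction n with
  | zero =>
    intro p hp
    have h0 : ∀ x, (p : Measure 𝒜).real {x} = 0 := by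
      intro x
      by_contra hx
      have : x ∈ Finset.univ.filter fun x => (p : Measure 𝒜).real {x} ≠ 0 := by simp [-ProbabilityMeasure.measureReal_eq_coe_coeFn, hx]
      rw [Finset.card_eq_zero.1 (Nat.le_zero.1 hp)] at this
      simp at this
    have := sum_real_singleton (p : Measure 𝒜)
    simp [-ProbabilityMeasure.measureReal_eq_coe_coeFn, h0] at this
  | succ n ih =>
    intro p hp
    obtain ⟨x, hx⟩ : ∃ x, (p : Measure 𝒜).real {x} ≠ 0 := by
      by_contra! h0
      have := sum_real_singleton (p : Measure 𝒜)
      simp [-ProbabilityMeasure.measureReal_eq_coe_coeFn, h0] at this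
    have hsum_mix : ∀ (w : unitInterval) (q : ProbabilityMeasure 𝒜),
        ∑ z, (mixture w (pointMass x) q : Measure 𝒜).real {z} * V (pointMass z)
          = w * V (pointMass x) + (1 - w) * ∑ z, (q : Measure 𝒜).real {z} * V (pointMass z) := by
      intro w q
      have hz : ∀ z, (mixture w (pointMass x) q : Measure 𝒜).real {z} * V (pointMass z)
          = (if z = x then w * V (pointMass x) else 0)
            + (1 - w) * ((q : Measure 𝒜).real {z} * V (pointMass z)) := by
        intro z
        rw [mixture_real]
        split_ifs with hzx
        · subst hzx
          rw [pointMass_real_self]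
          ring
        · rw [pointMass_real_of_ne hzx]
          ring
      rw [Finset.sum_congr rfl fun z _ => hz z, Finset.sum_add_distrib,
        Finset.sum_ite_eq' Finset.univ x, if_pos (Finset.mem_univ x), Finset.mul_sum]
    -- When all mass sits at `x` there is no law conditioned off `x`, so point masses are treated
    -- separately.
    by_cases h1 : (p : Measure 𝒜).real {x} = 1
    · have hpx : p = mixture 1 (pointMass x) p := by
        exact ext_of_real_singleton fun z => by
          rw [mixture_real]
          by_cases hz : z = x
          · subst hz
            simp [-ProbabilityMeasure.measureReal_eq_coe_coeFn, pointMass_real_self, h1]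
          · have hz0 : (p : Measure 𝒜).real {z} = 0 := by
              have hsub : (p : Measure 𝒜).real {z} ≤ (p : Measure 𝒜).real {x}ᶜ :=
                measureReal_mono (by simpa using Ne.symm hz)
              rw [probReal_compl_eq_one_sub (measurableSet_singleton x), h1, sub_self] at hsub
              exact le_antisymm hsub measureReal_nonneg
            simp [-ProbabilityMeasure.measureReal_eq_coe_coeFn, pointMass_real_of_ne hz, hz0]
      have hpx' : p = pointMass x := by
        rw [hpx]
        exact ext_of_real_singleton fun z => by simp [-ProbabilityMeasure.measureReal_eq_coe_coeFn, mixture_real]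
      subst hpx'
      have hent : entropy (pointMass x : Measure 𝒜) = 0 := by
        refine Finset.sum_eq_zero fun z _ => ?_
        by_cases hz : z = x
        · subst hz
          simp [-ProbabilityMeasure.measureReal_eq_coe_coeFn, pointMass_real_self]
        · simp [-ProbabilityMeasure.measureReal_eq_coe_coeFn, pointMass_real_of_ne hz]
      have hs := hsum_mix 1 (pointMass x)
      rw [← hpx] at hs
      rw [hs, hent]
      simp [-ProbabilityMeasure.measureReal_eq_coe_coeFn]
    · obtain ⟨w, q, hpq, hw, hqx, hsupp⟩ := exists_eq_mixture_pointMass h1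
      have hcardq : (Finset.univ.filter fun z => (q : Measure 𝒜).real {z} ≠ 0).card ≤ n := by
        refine Nat.le_of_lt_succ (lt_of_lt_of_le (Finset.card_lt_card ?_) hp)
        refine (Finset.ssubset_iff_of_subset fun z hz => ?_).2 ⟨x, by simp [-ProbabilityMeasure.measureReal_eq_coe_coeFn, hx], by simp [-ProbabilityMeasure.measureReal_eq_coe_coeFn, hqx]⟩
        simp only [Finset.mem_filter, Finset.mem_univ, true_and] at hz ⊢
        exact fun h0 => hz (hsupp z h0)
      rw [hpq, hchain w x q hqx, ih q hcardq, hsum_mix, entropy_mixture_pointMass w hqx, hHc]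
      ring

end Merge

/-! ### Uniqueness of the single-stage leakage -/

section Uniqueness

variable {𝒜 𝒴 : Type*} [Fintype 𝒜] [MeasurableSpace 𝒜] [DiscreteMeasurableSpace 𝒜]
  [MeasurableSpace 𝒴]

/-- The joint law of `(X, Y)` in which `Y = y₀` with probability `w` and `Y = y₁` otherwise, and
`X` has the law `p` or `q` accordingly. -/
def binaryLaw (w : unitInterval) (p q : ProbabilityMeasure 𝒜) (y₀ y₁ : 𝒴) :
    ProbabilityMeasure (𝒜 × 𝒴) :=
  mixture w (p.prod (pointMass y₀)) (q.prod (pointMass y₁))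

lemma binaryLaw_apply_prod (w : unitInterval) (p q : ProbabilityMeasure 𝒜) (y₀ y₁ : 𝒴)
    (s : Set 𝒜) (B : Set 𝒴) :
    (binaryLaw w p q y₀ y₁ : Measure (𝒜 × 𝒴)) (s ×ˢ B)
      = ENNReal.ofReal w * ((p : Measure 𝒜) s * Measure.dirac y₀ B)
        + ENNReal.ofReal (1 - w) * ((q : Measure 𝒜) s * Measure.dirac y₁ B) := by
  simp only [binaryLaw, toMeasure_mixture, ProbabilityMeasure.toMeasure_prod, toMeasure_pointMass,
    Measure.coe_add, Measure.coe_smul, Pi.add_apply, Pi.smul_apply, Measure.prod_prod, smul_eq_mul]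

lemma fst_binaryLaw (w : unitInterval) (p q : ProbabilityMeasure 𝒜) (y₀ y₁ : 𝒴) :
    (binaryLaw w p q y₀ y₁ : Measure (𝒜 × 𝒴)).fst = (mixture w p q : Measure 𝒜) := by
  ext s hs
  rw [Measure.fst_apply hs, ← Set.prod_univ, binaryLaw_apply_prod, toMeasure_mixture]
  simp

lemma snd_binaryLaw (w : unitInterval) (p q : ProbabilityMeasure 𝒜) (y₀ y₁ : 𝒴) :
    (binaryLaw w p q y₀ y₁ : Measure (𝒜 × 𝒴)).snd
      = ENNReal.ofReal w • Measure.dirac y₀ + ENNReal.ofReal (1 - w) • Measure.dirac y₁ := by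
  ext B hB
  rw [Measure.snd_apply hB, ← Set.univ_prod, binaryLaw_apply_prod]
  simp

lemma mapPrivate_binaryLaw (T : 𝒜 → 𝒜) (w : unitInterval) (p q : ProbabilityMeasure 𝒜)
    (y₀ y₁ : 𝒴) :
    mapPrivate T (binaryLaw w p q y₀ y₁)
      = binaryLaw w (p.map (Measurable.of_discrete (f := T)).aemeasurable)
        (q.map (Measurable.of_discrete (f := T)).aemeasurable) y₀ y₁ := by
  refine Subtype.ext (show (mapPrivate T (binaryLaw w p q y₀ y₁) : Measure (𝒜 × 𝒴)) = _ from
    ext_singleton_prod fun x B hB => ?_)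
  rw [toMeasure_mapPrivate, Measure.map_apply (measurable_prodMap_id T)
    ((measurableSet_singleton x).prod hB)]
  refine (binaryLaw_apply_prod w p q y₀ y₁ (T ⁻¹' {x}) B).trans ?_
  refine Eq.trans ?_ (binaryLaw_apply_prod w _ _ y₀ y₁ {x} B).symm
  rw [ProbabilityMeasure.toMeasure_map, ProbabilityMeasure.toMeasure_map,
    Measure.map_apply Measurable.of_discrete (measurableSet_singleton x),
    Measure.map_apply Measurable.of_discrete (measurableSet_singleton x)]

variable [StandardBorelSpace 𝒴]

open Classical in
lemma posterior_binaryLaw (w : unitInterval) (p q : ProbabilityMeasure 𝒜) {y₀ y₁ : 𝒴}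
    (hy : y₀ ≠ y₁) :
    ∀ᵐ y ∂(binaryLaw w p q y₀ y₁ : Measure (𝒜 × 𝒴)).snd,
      posterior (binaryLaw w p q y₀ y₁) y = if y = y₀ then p else q := by
  set κ : Kernel 𝒴 𝒜 := Kernel.piecewise (measurableSet_singleton y₀)
    (Kernel.const 𝒴 (p : Measure 𝒜)) (Kernel.const 𝒴 (q : Measure 𝒜)) with hκ
  have hκy : ∀ y, κ y = ((if y = y₀ then p else q : ProbabilityMeasure 𝒜) : Measure 𝒜) := by
    intro y
    rw [hκ, Kernel.piecewise_apply]
    by_cases h : y = y₀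
    · simp [h]
    · simp [h]
  have hmark : IsMarkovKernel κ := ⟨fun y => by rw [hκy]; infer_instance⟩
  have h := posterior_ae_eq (P := binaryLaw w p q y₀ y₁) (κ := κ) (by
    refine Measure.ext_prod fun {B} {s} hB hs => ?_
    rw [Measure.compProd_apply_prod hB hs, ← lintegral_indicator hB, snd_binaryLaw,
      lintegral_add_measure, lintegral_smul_measure, lintegral_smul_measure, lintegral_dirac,
      lintegral_dirac, Measure.map_apply measurable_swap (hB.prod hs), Set.preimage_swap_prod,
      binaryLaw_apply_prod, smul_eq_mul, smul_eq_mul, Measure.dirac_apply' _ hB,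
      Measure.dirac_apply' _ hB]
    simp only [Set.indicator_apply, hκy, if_neg hy.symm, if_true, Pi.one_apply, mul_ite, mul_one,
      mul_zero])
  filter_upwards [h] with y hy'
  exact Subtype.ext (hy'.trans (hκy y))

/-- The two values of `Y` have posteriors `p` and `q` with weights `w` and `1 - w`, so the drop is
exactly a concavity gap. This is where two distinct outputs are needed. -/
lemma envelopeDrop_binaryLaw (ℓ : 𝒜 → ProbabilityMeasure 𝒜 → EReal) (w : unitInterval)
    (p q : ProbabilityMeasure 𝒜) {y₀ y₁ : 𝒴} (hy : y₀ ≠ y₁) :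
    envelopeDrop ℓ (binaryLaw w p q y₀ y₁)
      = concavityGap (fun p => (bayesEnvelope ℓ p).toReal) w p q := by
  classical
  have hfst : (binaryLaw w p q y₀ y₁).map measurable_fst.aemeasurable = mixture w p q :=
    Subtype.ext (fst_binaryLaw w p q y₀ y₁)
  have hae : (fun y => (bayesEnvelope ℓ (posterior (binaryLaw w p q y₀ y₁) y)).toReal)
      =ᵐ[(binaryLaw w p q y₀ y₁ : Measure (𝒜 × 𝒴)).snd]
        fun y => (bayesEnvelope ℓ (if y = y₀ then p else q)).toReal := by
    filter_upwards [posterior_binaryLaw w p q hy] with y h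
    rw [h]
  have hint : ∀ (r : ℝ) (z : 𝒴), Integrable
      (fun y => (bayesEnvelope ℓ (if y = y₀ then p else q)).toReal)
      (ENNReal.ofReal r • Measure.dirac z) := fun r z =>
    (integrable_dirac (by simp)).smul_measure ENNReal.ofReal_ne_top
  rw [envelopeDrop, hfst, integral_congr_ae hae, snd_binaryLaw,
    integral_add_measure (hint _ _) (hint _ _), integral_smul_measure, integral_smul_measure,
    integral_dirac, integral_dirac, if_pos rfl, if_neg hy.symm, ENNReal.toReal_ofReal w.2.1,
    ENNReal.toReal_ofReal (sub_nonneg.2 w.2.2)]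
  rfl

/-- Merging the points other than `a` is sufficient when `Y = y₀` forces `X = a`. -/
lemma factorsThrough_merge [DecidableEq 𝒜] (w : unitInterval) {a b : 𝒜} (hab : a ≠ b)
    (p : ProbabilityMeasure 𝒜) (y₀ y₁ : 𝒴) :
    FactorsThrough (binaryLaw w (pointMass a) p y₀ y₁) (fun x => if x = a then a else b) := by
  intro x B hB
  by_cases hx : x = a
  · have : (fun x => if x = a then a else b) ⁻¹' {if x = a then a else b} = {x} := by
      ext z
      by_cases hz : z = a <;> simp [hz, hx, hab.symm]
    simp only [this]
    ring
  -- For `x ≠ a` the fibre is everything but `a`, which is charged only together with `y₁`. Both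
  -- sides then carry the same factors.
  · have : (fun x => if x = a then a else b) ⁻¹' {if x = a then a else b} = {a}ᶜ := by
      ext z
      by_cases hz : z = a <;> simp [hz, hx, hab]
    have h1 : (pointMass a : Measure 𝒜) {x} = 0 := by
      simp [toMeasure_pointMass, Ne.symm hx]
    have h2 : (pointMass a : Measure 𝒜) {a}ᶜ = 0 := by
      simp [toMeasure_pointMass]
    simp only [this, fst_binaryLaw, binaryLaw_apply_prod, toMeasure_mixture, Measure.coe_add,
      Measure.coe_smul, Pi.add_apply, Pi.smul_apply, smul_eq_mul, h1, h2, zero_mul, mul_zero,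
      zero_add]
    ring

/-- The merging map fixes the point mass at `a` and sends every law off `a` to the point mass at
`b`. The data-processing axiom thus equates the two gaps. -/
lemma concavityGap_merge {ℓ : 𝒜 → ProbabilityMeasure 𝒜 → EReal}
    {L : ProbabilityMeasure (𝒜 × 𝒴) → ℝ} (hL : IsPrivacyLeakage ℓ L) {y₀ y₁ : 𝒴} (hy : y₀ ≠ y₁)
    (w : unitInterval) {a b : 𝒜} (hab : a ≠ b) {p : ProbabilityMeasure 𝒜}
    (hp : (p : Measure 𝒜).real {a} = 0) :
    concavityGap (fun p => (bayesEnvelope ℓ p).toReal) w (pointMass a) p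
      = concavityGap (fun p => (bayesEnvelope ℓ p).toReal) w (pointMass a) (pointMass b) := by
  classical
  set T : 𝒜 → 𝒜 := fun x => if x = a then a else b with hT
  have hTm : Measurable T := Measurable.of_discrete
  have h := hL.dataProcessing (binaryLaw w (pointMass a) p y₀ y₁) T
    ((isSufficient_iff_factorsThrough _ _).2 (factorsThrough_merge w hab p y₀ y₁))
  have ha : (pointMass a).map hTm.aemeasurable = pointMass a := by
    refine Subtype.ext ((Measure.map_dirac' hTm a).trans ?_)
    simp only [hT, if_true]
    rfl
  have hb : p.map hTm.aemeasurable = pointMass b := by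
    have hpa : ∀ᵐ x ∂(p : Measure 𝒜), T x = b := by
      rw [ae_iff_of_countable]
      intro x hx
      have hxa : x ≠ a := by
        rintro rfl
        exact hx ((measureReal_eq_zero_iff (measure_ne_top _ _)).1 hp)
      simp [hT, hxa]
    refine Subtype.ext (show (p : Measure 𝒜).map T = Measure.dirac b from ?_)
    rw [Measure.map_congr (g := fun _ => b) hpa, Measure.map_const, measure_univ, one_smul]
  rw [mapPrivate_binaryLaw, ha, hb, hL.eq_envelopeDrop, hL.eq_envelopeDrop,
    envelopeDrop_binaryLaw _ _ _ _ hy, envelopeDrop_binaryLaw _ _ _ _ hy] at h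
  exact h.symm

/-- A constant output leaves the posterior equal to the prior. No binary disclosure exists here, so
this case is settled directly. -/
lemma envelopeDrop_of_subsingleton [Subsingleton 𝒴] (ℓ : 𝒜 → ProbabilityMeasure 𝒜 → EReal)
    (P : ProbabilityMeasure (𝒜 × 𝒴)) : envelopeDrop ℓ P = 0 := by
  have hpost : ∀ y, posterior P y = P.map measurable_fst.aemeasurable := by
    intro y
    refine Subtype.ext (show (posterior P y : Measure 𝒜) = (P : Measure (𝒜 × 𝒴)).fst from ?_)
    ext s hs
    have hconst : ∀ z, (posterior P z : Measure 𝒜) s = (posterior P y : Measure 𝒜) s :=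
      fun z => by rw [Subsingleton.elim z y]
    have h := lintegral_posterior P s MeasurableSet.univ
    rw [Measure.restrict_univ, lintegral_congr hconst, lintegral_const, measure_univ, mul_one] at h
    rw [h, Measure.fst_apply hs, Set.prod_univ]
  rw [envelopeDrop]
  simp_rw [hpost]
  simp

/-- On an alphabet with at least three letters, a leakage that obeys the data-processing axiom is
a multiple of the decrease of the entropy, unless nothing can be disclosed. -/
theorem IsPrivacyLeakage.exists_eq_mul_entropyDrop (hcard : 3 ≤ Fintype.card 𝒜)
    {ℓ : 𝒜 → ProbabilityMeasure 𝒜 → EReal} {L : ProbabilityMeasure (𝒜 × 𝒴) → ℝ}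
    (hL : IsPrivacyLeakage ℓ L) : ∃ c : ℝ, 0 ≤ c ∧ ∀ P, L P = c * entropyDrop P := by
  rcases subsingleton_or_nontrivial 𝒴 with h𝒴 | h𝒴
  · exact ⟨0, le_rfl, fun P => by
      rw [hL.eq_envelopeDrop, envelopeDrop_of_subsingleton, zero_mul]⟩
  · obtain ⟨y₀, y₁, hy⟩ := exists_pair_ne 𝒴
    obtain ⟨c, hc, hV⟩ := eq_affine_add_mul_entropy hcard
      (bayesEnvelope_mixture_ge hL.isLossFunction)
      (fun w a b p hab hp => concavityGap_merge hL hy w hab hp)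
    exact ⟨c, hc, fun P => (hL.eq_envelopeDrop P).trans (envelopeDrop_eq_mul_entropyDrop hV P)⟩

end Uniqueness

/-! ### Expected stage losses -/

section Kernels

open Real

/-- The posteriors are chosen separately for each `h`, without joint measurability in `(h, y)`. They
agree almost everywhere with `Kernel.condKernel`, which is jointly measurable. -/
lemma measurable_entropyDrop {H 𝒜 𝒴 : Type*} [MeasurableSpace H] [Fintype 𝒜] [Nonempty 𝒜]
    [MeasurableSpace 𝒜] [DiscreteMeasurableSpace 𝒜] [MeasurableSpace 𝒴] [StandardBorelSpace 𝒴]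
    (κ : Kernel H (𝒜 × 𝒴)) {P : H → ProbabilityMeasure (𝒜 × 𝒴)}
    (hP : ∀ h, (P h : Measure (𝒜 × 𝒴)) = κ h) :
    Measurable fun h => entropyDrop (P h) := by
  have hκ : IsMarkovKernel κ := ⟨fun h => by rw [← hP]; infer_instance⟩
  set ρ : Kernel H (𝒴 × 𝒜) := κ.map Prod.swap with hρ
  have hρm : IsMarkovKernel ρ := Kernel.IsMarkovKernel.map κ measurable_swap
  have hρP : ∀ h, ρ h = (P h : Measure (𝒜 × 𝒴)).map Prod.swap := fun h => by
    rw [hρ, Kernel.map_apply _ measurable_swap, hP]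
  have hfst : ∀ h, ρ.fst h = (P h : Measure (𝒜 × 𝒴)).snd := fun h => by
    rw [Kernel.fst_apply, hρP, Measure.map_map measurable_fst measurable_swap]
    rfl
  have hpost : ∀ h, ∀ᵐ y ∂(P h : Measure (𝒜 × 𝒴)).snd,
      (posterior (P h) y : Measure 𝒜) = ρ.condKernel (h, y) := by
    intro h
    have h1 := Kernel.condKernel_apply_eq_condKernel ρ h
    rw [hfst] at h1
    have h2 := posterior_ae_eq (P := P h) (κ := (ρ h).condKernel) (by
      rw [← hfst, Kernel.fst_apply, ← hρP]
      exact (ρ h).disintegrate _)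
    filter_upwards [h1, h2] with y hy1 hy2
    rw [hy1, hy2]
  have heq : ∀ h, entropyDrop (P h) = ∑ x, negMulLog ((κ h).real (Prod.fst ⁻¹' {x}))
      - ∫ y, ∑ x, negMulLog ((ρ.condKernel (h, y)).real {x}) ∂(ρ.fst h) := by
    intro h
    rw [entropyDrop, hfst]
    congr 1
    · refine Finset.sum_congr rfl fun x _ => ?_
      rw [measureReal_def, Measure.fst_apply (measurableSet_singleton x), hP, measureReal_def]
    · refine integral_congr_ae ?_
      filter_upwards [hpost h] with y hy
      rw [hy, entropy]
  simp_rw [heq]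
  refine Measurable.sub (Finset.measurable_sum _ fun x _ => ?_) ?_
  · exact continuous_negMulLog.measurable.comp
      (Kernel.measurable_coe κ (measurable_fst (measurableSet_singleton x))).ennreal_toReal
  · refine (StronglyMeasurable.integral_kernel_prod_right (κ := ρ.fst)
      (f := fun h y => ∑ x, negMulLog ((ρ.condKernel (h, y)).real {x})) ?_).measurable
    refine (Finset.measurable_sum _ fun x _ => ?_).stronglyMeasurable
    exact continuous_negMulLog.measurable.comp
      (Kernel.measurable_coe ρ.condKernel (measurableSet_singleton x)).ennreal_toReal

end Kernels

section Stages

variable {𝒳 𝒵 𝒴 𝒰 : Type*} [MeasurableSpace 𝒳] [MeasurableSpace 𝒵] [MeasurableSpace 𝒴]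
  [MeasurableSpace 𝒰] {T : ℕ}
  [Fintype 𝒳] [Nonempty 𝒳] [DiscreteMeasurableSpace 𝒳] [StandardBorelSpace 𝒴] [Nonempty 𝒴]

namespace Loop

instance (S : Loop 𝒳 𝒵 𝒴 𝒰 T) (t : Fin T) : IsFiniteMeasure (S.publicLaw t) := by
  unfold publicLaw
  infer_instance

/-- Mutual information is bounded in terms of the size of the private alphabet, uniformly in the
public history. -/
lemma stageInfo_ne_top (S : Loop 𝒳 𝒵 𝒴 𝒰 T) (t : Fin T) : S.stageInfo t ≠ ∞ := by
  refine ne_top_of_le_ne_top (b := ∫⁻ _,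
    ENNReal.ofReal (Fintype.card (Fin (t + 1) → 𝒳)) ∂(S.publicLaw t)) ?_ ?_
  · rw [lintegral_const]
    exact ENNReal.mul_ne_top ENNReal.ofReal_ne_top (measure_ne_top _ _)
  · refine lintegral_mono fun h => ?_
    rw [mutualInfo_eq_ofReal_entropyDrop]
    exact ENNReal.ofReal_le_ofReal (entropyDrop_le_card _)

lemma integral_entropyDrop_stageLaw (S : Loop 𝒳 𝒵 𝒴 𝒰 T) (t : Fin T) :
    ∫ h, entropyDrop (S.stageLaw t h) ∂(S.publicLaw t) = (S.stageInfo t).toReal := by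
  have hm : Measurable fun h => entropyDrop (S.stageLaw t h) :=
    measurable_entropyDrop
      (condDistrib (fun w => (privateVar t w, disclosedVar t w)) (publicVar t) S.law) fun _ => rfl
  rw [integral_eq_lintegral_of_nonneg_ae (ae_of_all _ fun h => entropyDrop_nonneg _)
    hm.aestronglyMeasurable, stageInfo]
  simp_rw [mutualInfo_eq_ofReal_entropyDrop]

/-- The fibres of an injective map are single letters, so relabelling `X^t` does not change the
information; the constant `c` is the same whichever embedding is used. -/
lemma expectedStageLoss_eq {𝒜 : Type*} [Fintype 𝒜] [MeasurableSpace 𝒜]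
    [DiscreteMeasurableSpace 𝒜] {L : ProbabilityMeasure (𝒜 × 𝒴) → ℝ} {c : ℝ}
    (hL : ∀ P, L P = c * entropyDrop P) (S : Loop 𝒳 𝒵 𝒴 𝒰 T) (t : Fin T)
    {e : (Fin (t + 1) → 𝒳) → 𝒜} (he : Function.Injective e) :
    S.expectedStageLoss t L e = c * (S.stageInfo t).toReal := by
  rw [expectedStageLoss, ← integral_entropyDrop_stageLaw, ← integral_const_mul]
  refine integral_congr_ae (ae_of_all _ fun h => ?_)
  simp only [hL, entropyDrop_mapPrivate (factorsThrough_of_injective _ he)]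

lemma toReal_directedInfo (S : Loop 𝒳 𝒵 𝒴 𝒰 T) :
    S.directedInfo.toReal = ∑ t, (S.stageInfo t).toReal :=
  ENNReal.toReal_sum fun t _ => S.stageInfo_ne_top t

end Loop

end Stages

lemma toHistory_injective {𝒳 : Type*} {T : ℕ} (t : Fin T) :
    Function.Injective (toHistory t : (Fin (t + 1) → 𝒳) → History 𝒳 T) :=
  fun x y h => by simpa [toHistory] using h

lemma card_le_card_histories (𝒳 : Type*) [Fintype 𝒳] (n : ℕ) :
    Fintype.card 𝒳 ≤ Fintype.card (Fin (n + 1) → 𝒳) :=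
  Fintype.card_le_of_injective (fun x _ => x) fun _ _ h => congrFun h 0

end CloudPrivacy

end

/-! ### Assembly of the stages -/

theorem mainTheorem1 {𝒳 𝒵 𝒴 𝒰 : Type*}
    [Fintype 𝒳] [Nonempty 𝒳] [MeasurableSpace 𝒳] [DiscreteMeasurableSpace 𝒳]
    [MeasurableSpace 𝒵] [StandardBorelSpace 𝒵]
    [MeasurableSpace 𝒴] [StandardBorelSpace 𝒴] [Nonempty 𝒴]
    [MeasurableSpace 𝒰] [StandardBorelSpace 𝒰]
    (h𝒳 : 3 ≤ Fintype.card 𝒳) (T : ℕ) :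
    (∀ S : CloudPrivacy.Loop 𝒳 𝒵 𝒴 𝒰 T, S.directedInfo ≠ ∞) ∧
    (∀ J : CloudPrivacy.Loop 𝒳 𝒵 𝒴 𝒰 T → ℝ,
      CloudPrivacy.SatisfiesPostulates J → (∃ S, J S ≠ 0) →
        ∃ c : ℝ, 0 < c ∧ ∀ S, J S = c * S.directedInfo.toReal) ∧
    (∀ c : ℝ, 0 < c →
      CloudPrivacy.SatisfiesPostulates
        (fun S : CloudPrivacy.Loop 𝒳 𝒵 𝒴 𝒰 T => c * S.directedInfo.toReal)) ∧
    (∀ J : CloudPrivacy.Loop 𝒳 𝒵 𝒴 𝒰 T → ℝ,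
      CloudPrivacy.SatisfiesStagewisePostulates J →
        ∃ c : Fin T → ℝ, (∀ t, 0 ≤ c t) ∧
          ∀ S, J S = ∑ t, c t * (S.stageInfo t).toReal) := by
  refine ⟨fun S => ENNReal.sum_ne_top.2 fun t _ => S.stageInfo_ne_top t, ?_, ?_, ?_⟩
  · rintro J ⟨ℓ, L, hL, hJ⟩ ⟨S₀, hS₀⟩
    -- For `T = 0` the sum over stages is empty and `J` vanishes. For positive `T` the histories of
    -- length one already supply three letters.
    have hT : 0 < T := by
      rcases Nat.eq_zero_or_pos T with rfl | hT
      · simp [hJ] at hS₀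
      · exact hT
    have hcard : 3 ≤ Fintype.card (CloudPrivacy.History 𝒳 T) :=
      (h𝒳.trans (CloudPrivacy.card_le_card_histories 𝒳 0)).trans
        (Fintype.card_le_of_injective _ (CloudPrivacy.toHistory_injective (⟨0, hT⟩ : Fin T)))
    obtain ⟨c, hc, hLc⟩ := hL.exists_eq_mul_entropyDrop hcard
    have hJc : ∀ S, J S = c * S.directedInfo.toReal := fun S => by
      rw [hJ, S.toReal_directedInfo, Finset.mul_sum]
      exact Finset.sum_congr rfl fun t _ =>
        S.expectedStageLoss_eq hLc t (CloudPrivacy.toHistory_injective t)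
    refine ⟨c, lt_of_le_of_ne hc ?_, hJc⟩
    rintro rfl
    exact hS₀ (by rw [hJc, zero_mul])
  · intro c hc
    -- The witness is the logarithmic loss scaled by `c` on the alphabet of all histories.
    refine ⟨_, _, CloudPrivacy.isPrivacyLeakage_logLoss hc.le, fun S => ?_⟩
    simp only [S.toReal_directedInfo, Finset.mul_sum]
    exact Finset.sum_congr rfl fun t _ =>
      (S.expectedStageLoss_eq (fun _ => rfl) t (CloudPrivacy.toHistory_injective t)).symm
  · rintro J ⟨ℓ, L, hL, hJ⟩
    choose c hc hLc using fun t => (hL t).exists_eq_mul_entropyDrop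
      (h𝒳.trans (CloudPrivacy.card_le_card_histories 𝒳 t))
    refine ⟨c, hc, fun S => ?_⟩
    rw [hJ]
    exact Finset.sum_congr rfl fun t _ =>
      S.expectedStageLoss_eq (hLc t) t Function.injective_id
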